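/- Let $\mathbb{H}$ be the quaternions, $\mathbb{B}=\{q\in\mathbb{H}:|q|<1\}$, $I_{1,1}=\mathrm{diag}(1,-1)$, and let $$\mathrm{Sp}(1,1)=\{A\in M_2(\mathbb{H}) : A^*I_{1,1}A=I_{1,1}\},\qquad \mathrm{Sp}(1)I_2=\{uI_2 : u\in\mathbb{H},\ |u|=1\}.$$ For functions $f(q)=\sum_{n\ge0}q^na_n$ and $g(q)=\sum_{n\ge0}q^nb_n$ given by convergent power series on $\mathbb{B}$ put $(f*g)(q)=\sum_{n\ge0}q^n\sum_{k=0}^n a_kb_{n-k}$, $f^c(q)=\sum_{n\ge0}q^n\overline{a_n}$, $f^s=f*f^c$, and $f^{-*}=(f^s)^{-1}f^c$ (pointwise, where $f^s\neq0$). For $A=\begin{pmatrix}a&c\\ b&d\end{pmatrix}\in\mathrm{Sp}(1,1)$ the regular Möbius transformation associated to $A$ is the map $$\mathcal{F}_A:\mathbb{B}\to\mathbb{B},\qquad \mathcal{F}_A=l_{(c,d)}^{-*}*l_{(a,b)},\qquad\text{where } l_{(a,b)}(q)=qa+b,$$ and $\mathcal{M}(\mathbb{B})=\{\mathcal{F}_A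 : A\in\mathrm{Sp}(1,1)\}$. By a manifold structure on a set we mean a Hausdorff second countable topology with a maximal smooth atlas of charts in $\mathbb{R}^n$ for some $n$. **Theorem.** The map $$\psi:\mathrm{Sp}(1,1)/\mathrm{Sp}(1)I_2\to\mathcal{M}(\mathbb{B}),\qquad A\,\mathrm{Sp}(1)I_2\mapsto\mathcal{F}_{A^{-1}},$$ on the set of left cosets, is a well-defined bijection. Furthermore, $\mathrm{Sp}(1,1)$ has a unique manifold structure as an embedded submanifold of $M_2(\mathbb{H})\cong\mathbb{R}^{16}$, and $\mathrm{Sp}(1,1)/\mathrm{Sp}(1)I_2$ has a unique manifold structure for which the quotient map from $\mathrm{Sp}(1,1)$ is a submersion (a surjective smooth map whose differential at every point is surjective). With respect to it, $\mathcal{M}(\mathbb{B})$ has a unique manifold structure for which $\psi$ is a diffeomorphism, and for this structure $\mathcal{M}(\mathbb{B})$ has dimension $7$. -/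

import Mathlib

open scoped Quaternion Manifold ContDiff Matrix

noncomputable section

/-! ### Smooth manifold structures on a set -/

/-- A smooth manifold structure (without boundary, of some dimension `dim`) on a set `X`:
a Hausdorff second countable topology together with a maximal smooth atlas of charts
with values in `ℝ ^ dim`. -/
structure SmoothStructure (X : Type*) where
  /-- the dimension of the manifold -/
  dim : ℕ
  [top : TopologicalSpace X]
  t2 : T2Space X
  secondCountable : SecondCountableTopology X
  /-- the set of all smooth charts -/
  atlas : Set (OpenPartialHomeomorph X (EuclideanSpace ℝ (Fin dim)))
  cover : ∀ x : X, ∃ e ∈ atlas, x ∈ e.source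
  compatible : ∀ e ∈ atlas, ∀ e' ∈ atlas,
    e.symm ≫ₕ e' ∈ contDiffGroupoid ∞ 𝓘(ℝ, EuclideanSpace ℝ (Fin dim))
  maximal : ∀ e : OpenPartialHomeomorph X (EuclideanSpace ℝ (Fin dim)),
    (∀ e' ∈ atlas, e.symm ≫ₕ e' ∈ contDiffGroupoid ∞ 𝓘(ℝ, EuclideanSpace ℝ (Fin dim)) ∧
      e'.symm ≫ₕ e ∈ contDiffGroupoid ∞ 𝓘(ℝ, EuclideanSpace ℝ (Fin dim))) → e ∈ atlas

namespace SmoothStructure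

variable {X Y : Type*}

/-- The model space of a smooth structure. -/
abbrev Model (S : SmoothStructure X) : Type := EuclideanSpace ℝ (Fin S.dim)

/-- The underlying Mathlib charted space. -/
@[reducible] def chartedSpace (S : SmoothStructure X) :
    @ChartedSpace S.Model _ X S.top :=
  letI := S.top
  { atlas := S.atlas
    chartAt := fun x => (S.cover x).choose
    mem_chart_source := fun x => (S.cover x).choose_spec.2
    chart_mem_atlas := fun x => (S.cover x).choose_spec.1 }

theorem isManifold (S : SmoothStructure X) :
    letI := S.top
    letI := S.chartedSpace
    IsManifold 𝓘(ℝ, S.Model) ∞ X := by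
  let _ := S.top
  let _ := S.chartedSpace
  have : HasGroupoid X (contDiffGroupoid ∞ 𝓘(ℝ, S.Model)) :=
    ⟨fun {e e'} he he' => S.compatible e he e' he'⟩
  exact IsManifold.mk' _ _ _

/-- `f` is a diffeomorphism from `X` with the structure `S` onto `Y` with the structure `T`. -/
def IsDiffeomorphism (S : SmoothStructure X) (T : SmoothStructure Y) (f : X → Y) : Prop :=
  letI := S.top
  letI := S.chartedSpace
  letI := T.top
  letI := T.chartedSpace
  ∃ Φ : Diffeomorph 𝓘(ℝ, S.Model) 𝓘(ℝ, T.Model) X Y ∞, ∀ x, Φ x = f x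

/-- `f` is a submersion: a surjective smooth map whose differential at every point is
surjective. -/
def IsSurjectiveSubmersion (S : SmoothStructure X) (T : SmoothStructure Y) (f : X → Y) : Prop :=
  letI := S.top
  letI := S.chartedSpace
  letI := T.top
  letI := T.chartedSpace
  Function.Surjective f ∧ ContMDiff 𝓘(ℝ, S.Model) 𝓘(ℝ, T.Model) ∞ f ∧
    ∀ x, Function.Surjective (mfderiv 𝓘(ℝ, S.Model) 𝓘(ℝ, T.Model) f x)

/-- `f` is a smooth embedding into the vector space `V`: a smooth map that is a homeomorphism
onto its image and whose differential at every point is injective. -/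
def IsEmbeddingInto {V : Type*} [NormedAddCommGroup V] [NormedSpace ℝ V]
    (S : SmoothStructure X) (f : X → V) : Prop :=
  letI := S.top
  letI := S.chartedSpace
  Topology.IsEmbedding f ∧ ContMDiff 𝓘(ℝ, S.Model) 𝓘(ℝ, V) ∞ f ∧
    ∀ x, Function.Injective (mfderiv 𝓘(ℝ, S.Model) 𝓘(ℝ, V) f x)

end SmoothStructure

/-! ### The groups `Sp(1,1)` and `Sp(1) I₂` -/

/-- The matrix `I_{1,1} = diag(1, -1)`. -/
def I11 : Matrix (Fin 2) (Fin 2) ℍ[ℝ] := !![1, 0; 0, -1]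

theorem I11_mul_I11 : I11 * I11 = 1 := by
  ext i j : 1
  fin_cases i <;> fin_cases j <;> simp [I11, Matrix.mul_apply]

theorem I11_conjTranspose : I11ᴴ = I11 := by
  ext i j : 1
  fin_cases i <;> fin_cases j <;> simp [I11]

/-- `Sp(1,1)`, the quaternionic `2 × 2` matrices with `A* I_{1,1} A = I_{1,1}`. -/
def Sp11 : Submonoid (Matrix (Fin 2) (Fin 2) ℍ[ℝ]) where
  carrier := {A | Aᴴ * I11 * A = I11}
  one_mem' := by simp
  mul_mem' := by
    intro A B hA hB
    simp only [Set.mem_ofPred_eq] at *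
    rw [Matrix.conjTranspose_mul]
    calc Bᴴ * Aᴴ * I11 * (A * B) = Bᴴ * (Aᴴ * I11 * A) * B := by simp only [mul_assoc]
      _ = I11 := by rw [hA, hB]

theorem mem_Sp11 {A : Matrix (Fin 2) (Fin 2) ℍ[ℝ]} : A ∈ Sp11 ↔ Aᴴ * I11 * A = I11 := Iff.rfl

theorem Sp11.inv_mul_aux {A : Matrix (Fin 2) (Fin 2) ℍ[ℝ]} (hA : A ∈ Sp11) :
    I11 * Aᴴ * I11 * A = 1 := by
  rw [mul_assoc, mul_assoc, ← mul_assoc Aᴴ, mem_Sp11.1 hA, I11_mul_I11]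

theorem Sp11.inv_mem {A : Matrix (Fin 2) (Fin 2) ℍ[ℝ]} (hA : A ∈ Sp11) :
    I11 * Aᴴ * I11 ∈ Sp11 := by
  have h : A * (I11 * Aᴴ * I11) = 1 := mul_eq_one_symm (Sp11.inv_mul_aux hA)
  have h2 : A * I11 * Aᴴ = I11 := by
    calc A * I11 * Aᴴ = A * (I11 * Aᴴ * I11) * I11 := by
          simp only [mul_assoc, I11_mul_I11, mul_one]
      _ = I11 := by rw [h, one_mul]
  rw [mem_Sp11]
  simp only [Matrix.conjTranspose_mul, Matrix.conjTranspose_conjTranspose, I11_conjTranspose]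
  calc I11 * (A * I11) * I11 * (I11 * Aᴴ * I11)
      = I11 * (A * I11 * (I11 * I11) * Aᴴ) * I11 := by simp only [mul_assoc]
    _ = I11 := by rw [I11_mul_I11, mul_one, h2, I11_mul_I11, one_mul]

/-- `Sp(1,1)` is a group under matrix multiplication, with `A⁻¹ = I_{1,1} A* I_{1,1}`. -/
instance : Group Sp11 :=
  { (inferInstance : Monoid Sp11) with
    inv := fun A => ⟨I11 * A.1ᴴ * I11, Sp11.inv_mem A.2⟩
    inv_mul_cancel := fun A => Subtype.ext (Sp11.inv_mul_aux A.2) }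

/-- The subgroup `Sp(1) I₂` of `Sp(1,1)`, consisting of the matrices `u I₂` with `|u| = 1`. -/
def Sp1I2 : Subgroup Sp11 where
  carrier := {A | ∃ u : ℍ[ℝ], ‖u‖ = 1 ∧ A.1 = Matrix.diagonal (fun _ => u)}
  one_mem' := ⟨1, by simp, by simp⟩
  mul_mem' := by
    rintro A B ⟨u, hu, hA⟩ ⟨v, hv, hB⟩
    exact ⟨u * v, by simp [hu, hv], by simp [hA, hB]⟩
  inv_mem' := by
    rintro A ⟨u, hu, hA⟩
    refine ⟨star u, by simpa using hu, ?_⟩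
    change I11 * A.1ᴴ * I11 = _
    rw [hA, Matrix.diagonal_conjTranspose]
    ext i j : 1
    fin_cases i <;> fin_cases j <;> simp [I11, Matrix.mul_apply, Matrix.vecMul_diagonal]

/-- The inclusion of `Sp(1,1)` into the real vector space `M₂(ℍ)`, normed as a space of
functions of the two indices. -/
def Sp11.incl (A : Sp11) : Fin 2 → Fin 2 → ℍ[ℝ] := fun i j => A.1 i j

/-! ### Power series of a quaternionic variable and the `*`-product -/

/-- The unit ball of the quaternions. -/
abbrev QBall : Set ℍ[ℝ] := Metric.ball (0 : ℍ[ℝ]) 1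

/-- `f(q) = ∑ qⁿ aₙ` on the unit ball. -/
def HasRegularExpansion (f : QBall → ℍ[ℝ]) (a : ℕ → ℍ[ℝ]) : Prop :=
  ∀ q : QBall, HasSum (fun n => (q : ℍ[ℝ]) ^ n * a n) (f q)

/-- The coefficients of a power series expansion are determined by the function. -/
theorem HasRegularExpansion.unique {f : QBall → ℍ[ℝ]} {a b : ℕ → ℍ[ℝ]}
    (ha : HasRegularExpansion f a) (hb : HasRegularExpansion f b) : a = b := by
  classical
  let g : ℝ → ℍ[ℝ] := fun t => if h : (t : ℍ[ℝ]) ∈ QBall then f ⟨t, h⟩ else 0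
  have key : ∀ c : ℕ → ℍ[ℝ], HasRegularExpansion f c →
      HasFPowerSeriesAt g
        (fun n => ContinuousMultilinearMap.mkPiRing ℝ (Fin n) (c n) :
          FormalMultilinearSeries ℝ ℝ ℍ[ℝ]) 0 := by
    intro c hc
    refine hasFPowerSeriesAt_iff.2 ?_
    filter_upwards [Metric.ball_mem_nhds (0 : ℝ) one_pos] with t ht
    have ht' : (t : ℍ[ℝ]) ∈ QBall := by
      rw [mem_ball_zero_iff] at ht ⊢
      rwa [Quaternion.norm_coe]
    have hg : g (0 + t) = f ⟨t, ht'⟩ := by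
      simp only [zero_add, g]
      rw [dif_pos ht']
    rw [hg]
    have hterm : ∀ n : ℕ, t ^ n • FormalMultilinearSeries.coeff
        (fun n => ContinuousMultilinearMap.mkPiRing ℝ (Fin n) (c n) :
          FormalMultilinearSeries ℝ ℝ ℍ[ℝ]) n = (t : ℍ[ℝ]) ^ n * c n := by
      intro n
      rw [← Quaternion.coe_pow, Quaternion.coe_mul_eq_smul]
      congr 1
      refine (ContinuousMultilinearMap.mkPiRing_apply (c n) (1 : Fin n → ℝ)).trans ?_
      simp
    simp only [hterm]
    exact hc ⟨t, ht'⟩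
  have h := (key a ha).eq_formalMultilinearSeries (key b hb)
  funext n
  exact (ContinuousMultilinearMap.mkPiRing_eq_iff).1 (congrFun h n)

open Classical in
/-- The coefficients of the power series expansion of `f` on the unit ball (zero if `f` has no
such expansion, that is, if `f` is not slice regular). -/
def regularCoeff (f : QBall → ℍ[ℝ]) : ℕ → ℍ[ℝ] :=
  if h : ∃ a, HasRegularExpansion f a then h.choose else 0

theorem HasRegularExpansion.regularCoeff_eq {f : QBall → ℍ[ℝ]} {a : ℕ → ℍ[ℝ]}
    (ha : HasRegularExpansion f a) : regularCoeff f = a := by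
  have h : ∃ a, HasRegularExpansion f a := ⟨a, ha⟩
  rw [regularCoeff, dif_pos h]
  exact h.choose_spec.unique ha

/-- The function `q ↦ ∑ qⁿ aₙ` on the unit ball. -/
def regularSeries (a : ℕ → ℍ[ℝ]) : QBall → ℍ[ℝ] := fun q => ∑' n, (q : ℍ[ℝ]) ^ n * a n

/-- The regular product `f * g`, with coefficients `cₙ = ∑_{k ≤ n} aₖ bₙ₋ₖ`. -/
def starProd (f g : QBall → ℍ[ℝ]) : QBall → ℍ[ℝ] :=
  regularSeries fun n => ∑ k ∈ Finset.range (n + 1), regularCoeff f k * regularCoeff g (n - k)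

/-- The regular conjugate `f^c`. -/
def regularConj (f : QBall → ℍ[ℝ]) : QBall → ℍ[ℝ] :=
  regularSeries fun n => star (regularCoeff f n)

/-- The symmetrization `f^s = f * f^c`. -/
def symmetrization (f : QBall → ℍ[ℝ]) : QBall → ℍ[ℝ] := starProd f (regularConj f)

/-- The regular reciprocal `f^{-*} = (1 / f^s) f^c`, meaningful where `f^s` does not vanish. -/
def regularReciprocal (f : QBall → ℍ[ℝ]) : QBall → ℍ[ℝ] :=
  fun q => (symmetrization f q)⁻¹ * regularConj f q

/-- The function `l_{(a,b)}(q) = q a + b`. -/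
def linearFun (a b : ℍ[ℝ]) : QBall → ℍ[ℝ] := fun q => (q : ℍ[ℝ]) * a + b

/-- The regular Möbius transformation `𝓕_A = l_{(c,d)}^{-*} * l_{(a,b)}` for the matrix `A` with
rows `(a, c)` and `(b, d)`, as a map from the ball into the quaternions. -/
def regularMobius (A : Sp11) : QBall → ℍ[ℝ] :=
  starProd (regularReciprocal (linearFun (A.1 0 1) (A.1 1 1))) (linearFun (A.1 0 0) (A.1 1 0))

/-- The set `𝓜(𝔹)` of the maps `𝓕_A : 𝔹 → 𝔹` with `A` in `Sp(1,1)`. -/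
def RegularMobiusMaps : Set (QBall → QBall) :=
  {F | ∃ A : Sp11, ∀ q : QBall, (F q : ℍ[ℝ]) = regularMobius A q}

/-! ### The manifold structures of `Sp(1,1)` and of its quotient -/

/-- `G` makes `Sp(1,1)` an embedded submanifold of `M₂(ℍ)`. -/
def IsSubmanifoldStructure (G : SmoothStructure Sp11) : Prop :=
  G.IsEmbeddingInto Sp11.incl

/-- `Q` makes the projection of `Sp(1,1)`, with the structure `G`, onto the set of left cosets
of `Sp(1) I₂` a submersion. -/
def IsQuotientStructure (G : SmoothStructure Sp11) (Q : SmoothStructure (Sp11 ⧸ Sp1I2)) : Prop :=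
  G.IsSurjectiveSubmersion Q (fun A : Sp11 => (A : Sp11 ⧸ Sp1I2))

end

/-!
For `A` with rows `(a, c)` and `(b, d)`, the coefficients of `𝓕_A` of degree at most two determine
`d⁻¹ a`, `d⁻¹ b` and `d⁻¹ c`, hence `A` up to left multiplication by a unit quaternion. At a point
`q` of the ball, `𝓕_A(q) = (d + p c)⁻¹ (b + p a)` for a conjugate `p` of `q`, and
`|d + p c|² + |p|² = 1 + |b + p a|²`, so that `𝓕_A` maps the ball into itself.

Polar decomposition identifies `Sp(1,1)` with `ℍ × S³ × S³` in such a way that the right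
multiplication by `u` in `Sp(1)` becomes `(v, s, t) ↦ (v, s u, t u)`; thus
`(v, s, t) ↦ (v, t s⁻¹)` identifies the set of left cosets with `ℍ × S³`, of dimension `7`.
The structures are unique because the smoothness of a continuous map into an immersed manifold, or
of a map out of the target of a surjective submersion, can be tested after composition with the
immersion or the submersion.
-/

open Set Filter Topology

/-! ### Maps with a left or right invertible derivative -/

section LocalInverse

variable {𝕜 E F : Type*} [RCLike 𝕜] [NormedAddCommGroup E] [NormedSpace 𝕜 E]
  [NormedAddCommGroup F] [NormedSpace 𝕜 F] {n : WithTop ℕ∞} {f : E → F} {f' : E →L[𝕜] F} {x : E}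

theorem exists_contDiffAt_local_leftInverse [CompleteSpace E] (hf : ContDiffAt 𝕜 n f x)
    (hf' : HasFDerivAt f f' x) (hinv : f'.HasLeftInverse) (hn : n ≠ 0) :
    ∃ g : F → E, ContDiffAt 𝕜 n g (f x) ∧ ∀ᶠ y in 𝓝 x, g (f y) = y := by
  obtain ⟨L, hL⟩ := hinv
  have hLf : ContDiffAt 𝕜 n (L ∘ f) x := L.contDiff.contDiffAt.comp x hf
  have hLf' : HasFDerivAt (L ∘ f) (ContinuousLinearEquiv.refl 𝕜 E : E →L[𝕜] E) x := by
    convert L.hasFDerivAt.comp x hf'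
    ext v
    exact (hL v).symm
  refine ⟨hLf.localInverse hLf' hn ∘ L, ?_,
    (hLf.hasStrictFDerivAt' hLf' hn).eventually_left_inverse⟩
  exact (hLf.to_localInverse hLf' hn).comp (f x) L.contDiff.contDiffAt

theorem exists_contDiffAt_local_rightInverse [CompleteSpace F] (hf : ContDiffAt 𝕜 n f x)
    (hf' : HasFDerivAt f f' x) (hinv : f'.HasRightInverse) (hn : n ≠ 0) :
    ∃ g : F → E, g (f x) = x ∧ ContDiffAt 𝕜 n g (f x) ∧ ∀ᶠ z in 𝓝 (f x), f (g z) = z := by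
  obtain ⟨R, hR⟩ := hinv
  let slice : F → E := fun v => x + R v
  have slice_zero : slice 0 = x := by simp only [slice, map_zero, add_zero]
  have hslice : ContDiff 𝕜 n slice := contDiff_const.add R.contDiff
  have hh : ContDiffAt 𝕜 n (f ∘ slice) 0 :=
    ContDiffAt.comp 0 (slice_zero.symm ▸ hf) hslice.contDiffAt
  have hh' : HasFDerivAt (f ∘ slice) (ContinuousLinearEquiv.refl 𝕜 F : F →L[𝕜] F) 0 := by
    convert HasFDerivAt.comp 0 (slice_zero.symm ▸ hf') (R.hasFDerivAt.const_add x)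
    ext v
    exact (hR v).symm
  let k := hh.localInverse hh' hn
  have hfx : (f ∘ slice) 0 = f x := congrArg f slice_zero
  have hk0 : k (f x) = 0 := hfx ▸ hh.localInverse_apply_image hh' hn
  refine ⟨slice ∘ k, ?_, ?_, ?_⟩
  · rw [Function.comp_apply, hk0, slice_zero]
  · exact hslice.contDiffAt.comp (f x) (hfx ▸ hh.to_localInverse hh' hn)
  · exact hfx ▸ (hh.hasStrictFDerivAt' hh' hn).eventually_right_inverse

end LocalInverse

section LocalInverseManifold

variable {𝕜 E E' E'' H H' H'' M N P : Type*} [RCLike 𝕜]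
  [NormedAddCommGroup E] [NormedSpace 𝕜 E] [TopologicalSpace H] {I : ModelWithCorners 𝕜 E H}
  [NormedAddCommGroup E'] [NormedSpace 𝕜 E'] [TopologicalSpace H'] {J : ModelWithCorners 𝕜 E' H'}
  [NormedAddCommGroup E''] [NormedSpace 𝕜 E''] [TopologicalSpace H'']
  {K : ModelWithCorners 𝕜 E'' H''}
  [TopologicalSpace M] [ChartedSpace H M] [TopologicalSpace N] [ChartedSpace H' N]
  [TopologicalSpace P] [ChartedSpace H'' P]
  {n : WithTop ℕ∞} {f : M → N} {x : M}

theorem contDiffAt_writtenInExtChartAt [I.Boundaryless] (hf : ContMDiffAt I J n f x) :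
    ContDiffAt 𝕜 n (writtenInExtChartAt I J x f) (extChartAt I x x) := by
  have h := (contMDiffAt_iff.1 hf).2
  rwa [I.range_eq_univ, contDiffWithinAt_univ] at h

theorem hasFDerivAt_writtenInExtChartAt [I.Boundaryless] (hf : MDifferentiableAt I J f x) :
    HasFDerivAt (writtenInExtChartAt I J x f) (mfderiv I J f x) (extChartAt I x x) := by
  have h := hf.hasMFDerivAt.2
  rw [I.range_eq_univ] at h
  exact hasFDerivWithinAt_univ.1 h

theorem contMDiffAt_extChartAt_symm [I.Boundaryless] [IsManifold I n M] (x : M) :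
    ContMDiffAt 𝓘(𝕜, E) I n (extChartAt I x).symm (extChartAt I x x) :=
  (contMDiffOn_extChartAt_symm x).contMDiffAt (extChartAt_target_mem_nhds x)

theorem exists_contMDiffAt_local_leftInverse [CompleteSpace E] [I.Boundaryless] [IsManifold I n M]
    (hf : ContMDiffAt I J n f x) (hinv : (mfderiv I J f x).HasLeftInverse) (hn : n ≠ 0) :
    ∃ g : N → M, ContMDiffAt J I n g (f x) ∧ ∀ᶠ y in 𝓝 x, g (f y) = y := by
  let c := extChartAt I x
  let c' := extChartAt J (f x)
  obtain ⟨g, hg, hgf⟩ := exists_contDiffAt_local_leftInverse (contDiffAt_writtenInExtChartAt hf)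
    (hasFDerivAt_writtenInExtChartAt (hf.mdifferentiableAt hn)) hinv hn
  rw [show writtenInExtChartAt I J x f (c x) = c' (f x) by
    simp only [writtenInExtChartAt, Function.comp_apply, c, c', extChartAt_to_inv]] at hg
  have hgf' : ∀ᶠ y in 𝓝 x, g (c' (f y)) = c y := by
    filter_upwards [(continuousAt_extChartAt x).eventually hgf,
      extChartAt_source_mem_nhds (I := I) x] with y hgy hy
    simpa only [c, c', writtenInExtChartAt, Function.comp_apply, (extChartAt I x).left_inv hy]
      using hgy
  refine ⟨c.symm ∘ g ∘ c', ?_, ?_⟩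
  · refine ContMDiffAt.comp (f x) ?_ (hg.contMDiffAt.comp (f x) contMDiffAt_extChartAt)
    rw [Function.comp_apply, hgf'.self_of_nhds]
    exact contMDiffAt_extChartAt_symm x
  · filter_upwards [hgf', extChartAt_source_mem_nhds (I := I) x] with y hgy hy
    exact (congrArg c.symm hgy).trans (c.left_inv hy)

theorem exists_contMDiffAt_local_rightInverse [CompleteSpace E'] [I.Boundaryless]
    [IsManifold I n M] (hf : ContMDiffAt I J n f x) (hinv : (mfderiv I J f x).HasRightInverse)
    (hn : n ≠ 0) :
    ∃ g : N → M, ContMDiffAt J I n g (f x) ∧ ∀ᶠ z in 𝓝 (f x), f (g z) = z := by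
  let c := extChartAt I x
  let c' := extChartAt J (f x)
  obtain ⟨g, hgx, hg, hfg⟩ :=
    exists_contDiffAt_local_rightInverse (contDiffAt_writtenInExtChartAt hf)
      (hasFDerivAt_writtenInExtChartAt (hf.mdifferentiableAt hn)) hinv hn
  rw [show writtenInExtChartAt I J x f (c x) = c' (f x) by
    simp only [writtenInExtChartAt, Function.comp_apply, c, c', extChartAt_to_inv]] at hgx hg hfg
  have hs : ContMDiffAt J I n (c.symm ∘ g ∘ c') (f x) := by
    refine ContMDiffAt.comp (f x) ?_ (hg.contMDiffAt.comp (f x) contMDiffAt_extChartAt)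
    rw [Function.comp_apply, hgx]
    exact contMDiffAt_extChartAt_symm x
  have hsx : (c.symm ∘ g ∘ c') (f x) = x := by
    simp only [Function.comp_apply, hgx, c, extChartAt_to_inv]
  have mem_source : ∀ᶠ z in 𝓝 (f x), f ((c.symm ∘ g ∘ c') z) ∈ c'.source :=
    (ContinuousAt.comp (by rw [hsx]; exact hf.continuousAt) hs.continuousAt).eventually
      (by rw [Function.comp_apply, hsx]; exact extChartAt_source_mem_nhds (f x))
  refine ⟨c.symm ∘ g ∘ c', hs, ?_⟩
  filter_upwards [mem_source, extChartAt_source_mem_nhds (I := J) (f x),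
    (continuousAt_extChartAt (f x)).eventually hfg] with z hsz hz hfgz
  exact c'.injOn hsz hz hfgz

theorem contMDiff_of_comp_immersion [CompleteSpace E] [I.Boundaryless] [IsManifold I n M]
    {g : P → M} (hf : ContMDiff I J n f) (hinv : ∀ x, (mfderiv I J f x).HasLeftInverse)
    (hg : Continuous g) (hfg : ContMDiff K J n (f ∘ g)) (hn : n ≠ 0) : ContMDiff K I n g := by
  intro y
  obtain ⟨k, hk, hkf⟩ := exists_contMDiffAt_local_leftInverse (hf (g y)) (hinv (g y)) hn
  refine (hk.comp y (hfg y)).congr_of_eventuallyEq ?_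
  filter_upwards [hg.continuousAt.eventually hkf] with z hz
  exact hz.symm

theorem contMDiff_of_comp_submersion [CompleteSpace E'] [I.Boundaryless] [IsManifold I n M]
    {h : N → P} (hf : ContMDiff I J n f) (hinv : ∀ x, (mfderiv I J f x).HasRightInverse)
    (hsurj : Function.Surjective f) (hhf : ContMDiff I K n (h ∘ f)) (hn : n ≠ 0) :
    ContMDiff J K n h := by
  intro y
  obtain ⟨x, rfl⟩ := hsurj y
  obtain ⟨s, hs, hfs⟩ := exists_contMDiffAt_local_rightInverse (hf x) (hinv x) hn
  refine ((hhf (s (f x))).comp (f x) hs).congr_of_eventuallyEq ?_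
  filter_upwards [hfs] with z hz
  exact (congrArg h hz).symm

theorem hasLeftInverse_mfderiv [FiniteDimensional 𝕜 E']
    (h : Function.Injective (mfderiv I J f x)) : (mfderiv I J f x).HasLeftInverse := by
  let D : E →L[𝕜] E' := mfderiv I J f x
  have hD : D.HasLeftInverse := .of_injective_of_finiteDimensional h
  exact hD

theorem hasRightInverse_mfderiv [FiniteDimensional 𝕜 E']
    (h : Function.Surjective (mfderiv I J f x)) : (mfderiv I J f x).HasRightInverse := by
  let D : E →L[𝕜] E' := mfderiv I J f x
  have hD : D.HasRightInverse := .of_surjective_of_finiteDimensional h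
  exact hD

end LocalInverseManifold

section DifferentialComposition

variable {𝕜 E E' E'' H H' H'' M N P : Type*} [NontriviallyNormedField 𝕜]
  [NormedAddCommGroup E] [NormedSpace 𝕜 E] [TopologicalSpace H] {I : ModelWithCorners 𝕜 E H}
  [NormedAddCommGroup E'] [NormedSpace 𝕜 E'] [TopologicalSpace H'] {J : ModelWithCorners 𝕜 E' H'}
  [NormedAddCommGroup E''] [NormedSpace 𝕜 E''] [TopologicalSpace H'']
  {K : ModelWithCorners 𝕜 E'' H''}
  [TopologicalSpace M] [ChartedSpace H M] [TopologicalSpace N] [ChartedSpace H' N]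
  [TopologicalSpace P] [ChartedSpace H'' P]

theorem mfderiv_injective_of_comp {f : M → N} {g : N → P} {x : M}
    (hg : MDifferentiableAt J K g (f x)) (hf : MDifferentiableAt I J f x)
    (h : Function.Injective (mfderiv I K (g ∘ f) x)) : Function.Injective (mfderiv I J f x) := by
  rw [mfderiv_comp x hg hf] at h
  exact Function.Injective.of_comp h

theorem mfderiv_surjective_of_rightInverse {f : M → N} {g : N → M} {x : M}
    (hf : MDifferentiableAt I J f x) (hg : MDifferentiableAt J I g (f x)) (hgx : g (f x) = x)
    (hfg : Function.RightInverse g f) : Function.Surjective (mfderiv I J f x) := by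
  have comp_eq := mfderiv_comp_of_eq hf hg hgx
  rw [hfg.comp_eq_id, mfderiv_id, hgx] at comp_eq
  exact fun v => ⟨_, (DFunLike.congr_fun comp_eq v).symm⟩

theorem mfderiv_prodMap_injective {V W : Type*} [NormedAddCommGroup V] [NormedSpace 𝕜 V]
    [NormedAddCommGroup W] [NormedSpace 𝕜 W] {f : M → V} {g : N → W} {p : M × N}
    (hf : MDifferentiableAt I 𝓘(𝕜, V) f p.1) (hg : MDifferentiableAt J 𝓘(𝕜, W) g p.2)
    (hf_inj : Function.Injective (mfderiv I 𝓘(𝕜, V) f p.1))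
    (hg_inj : Function.Injective (mfderiv J 𝓘(𝕜, W) g p.2)) :
    Function.Injective (mfderiv (I.prod J) 𝓘(𝕜, V × W) (Prod.map f g) p) := by
  rw [modelWithCornersSelf_prod, ← chartedSpaceSelf_prod, mfderiv_prodMap hf hg]
  exact hf_inj.prodMap hg_inj

end DifferentialComposition

/-! ### Smooth structures -/

namespace SmoothStructure

variable {X Y Z V : Type*} [NormedAddCommGroup V] [NormedSpace ℝ V]

/-- The set `X` regarded as a manifold by means of the smooth structure `S`. It is a copy of `X`,
so that a manifold structure on `X` itself cannot interfere with `S`. -/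
def Space (_ : SmoothStructure X) : Type _ := X

instance (S : SmoothStructure X) : TopologicalSpace S.Space := S.top

instance (S : SmoothStructure X) : T2Space S.Space := S.t2

instance (S : SmoothStructure X) : SecondCountableTopology S.Space := S.secondCountable

noncomputable instance (S : SmoothStructure X) : ChartedSpace S.Model S.Space := S.chartedSpace

instance (S : SmoothStructure X) : IsManifold 𝓘(ℝ, S.Model) ∞ S.Space := S.isManifold

/-- `f` is smooth with respect to the structures `S` and `T`. -/
def SmoothMap (S : SmoothStructure X) (T : SmoothStructure Y) (f : X → Y) : Prop :=
  ContMDiff (M := S.Space) (M' := T.Space) 𝓘(ℝ, S.Model) 𝓘(ℝ, T.Model) ∞ f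

section Uniqueness

variable {S : SmoothStructure X} {T : SmoothStructure Y} {U : SmoothStructure Z}

theorem SmoothMap.comp {g : Y → Z} {f : X → Y} (hg : T.SmoothMap U g) (hf : S.SmoothMap T f) :
    S.SmoothMap U (g ∘ f) :=
  ContMDiff.comp (M := S.Space) (M' := T.Space) (M'' := U.Space) hg hf

theorem contMDiffOn_of_mem_atlas (S : SmoothStructure X)
    {e : OpenPartialHomeomorph S.Space S.Model} (he : e ∈ S.atlas) :
    ContMDiffOn 𝓘(ℝ, S.Model) 𝓘(ℝ, S.Model) ∞ e e.source :=
  contMDiffOn_of_mem_maximalAtlas (StructureGroupoid.subset_maximalAtlas _ he)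

theorem contMDiffOn_symm_of_mem_atlas (S : SmoothStructure X)
    {e : OpenPartialHomeomorph S.Space S.Model} (he : e ∈ S.atlas) :
    ContMDiffOn 𝓘(ℝ, S.Model) 𝓘(ℝ, S.Model) ∞ e.symm e.target :=
  contMDiffOn_symm_of_mem_maximalAtlas (StructureGroupoid.subset_maximalAtlas _ he)

theorem SmoothMap.contDiffOn_charts {f : X → Y} (hf : S.SmoothMap T f)
    {e : OpenPartialHomeomorph S.Space S.Model} (he : e ∈ S.atlas)
    {e' : OpenPartialHomeomorph T.Space T.Model} (he' : e' ∈ T.atlas) :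
    ContDiffOn ℝ ∞ (e' ∘ f ∘ e.symm) (e.target ∩ e.symm ⁻¹' (f ⁻¹' e'.source)) := by
  rw [← contMDiffOn_iff_contDiffOn]
  refine (T.contMDiffOn_of_mem_atlas he').comp (M' := T.Space) ?_ fun _ hv => hv.2
  exact hf.comp_contMDiffOn ((S.contMDiffOn_symm_of_mem_atlas he).mono inter_subset_left)

theorem dim_eq_of_smoothMap [Nonempty X] (f : X ≃ Y) (hf : S.SmoothMap T f)
    (hf' : T.SmoothMap S f.symm) : S.dim = T.dim := by
  let Φ : S.Space ≃ₘ^∞⟮𝓘(ℝ, S.Model), 𝓘(ℝ, T.Model)⟯ T.Space := ⟨f, hf, hf'⟩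
  have e : S.Model ≃L[ℝ] T.Model :=
    Φ.mfderivToContinuousLinearEquiv (by simp) (Classical.arbitrary X)
  simpa only [finrank_euclideanSpace_fin] using e.toLinearEquiv.finrank_eq

theorem mem_contDiffGroupoid_of_contDiffOn {e : OpenPartialHomeomorph V V}
    (he : ContDiffOn ℝ ∞ e e.source) (he' : ContDiffOn ℝ ∞ e.symm e.target) :
    e ∈ contDiffGroupoid ∞ 𝓘(ℝ, V) := by
  rw [contDiffGroupoid, mem_groupoid_of_pregroupoid]
  simpa [contDiffPregroupoid] using ⟨he, he'⟩

theorem mem_atlas_of_contDiffOn (S : SmoothStructure X) {e : OpenPartialHomeomorph S.Space S.Model}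
    (h : ∀ e' : OpenPartialHomeomorph S.Space S.Model, e' ∈ S.atlas →
      ContDiffOn ℝ ∞ (e.symm ≫ₕ e') (e.symm ≫ₕ e').source ∧
        ContDiffOn ℝ ∞ (e'.symm ≫ₕ e) (e'.symm ≫ₕ e).source) :
    e ∈ S.atlas :=
  S.maximal e fun e' he' => ⟨mem_contDiffGroupoid_of_contDiffOn (h e' he').1 (h e' he').2,
    mem_contDiffGroupoid_of_contDiffOn (h e' he').2 (h e' he').1⟩

theorem eq_of_smoothMap_id [Nonempty X] {S T : SmoothStructure X} (hST : S.SmoothMap T id)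
    (hTS : T.SmoothMap S id) : S = T := by
  have hdim : S.dim = T.dim := dim_eq_of_smoothMap (Equiv.refl X) hST hTS
  have htop : S.top = T.top :=
    le_antisymm (continuous_id_iff_le.1 hST.continuous) (continuous_id_iff_le.1 hTS.continuous)
  have toT := @hST.contDiffOn_charts
  have toS := @hTS.contDiffOn_charts
  have memS := @S.mem_atlas_of_contDiffOn
  have memT := @T.mem_atlas_of_contDiffOn
  clear hST hTS
  obtain ⟨m, _, _, A, _, _, _⟩ := S
  obtain ⟨n, _, _, B, _, _, _⟩ := T
  dsimp only at hdim htop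
  subst hdim htop
  congr 1
  ext e
  exact ⟨fun he => memT fun e' he' => ⟨toT he he', toS he' he⟩,
    fun he => memS fun e' he' => ⟨toS he he', toT he' he⟩⟩

theorem isEmbeddingInto_iff {f : X → V} : S.IsEmbeddingInto f ↔
    IsEmbedding (X := S.Space) f ∧ ContMDiff (M := S.Space) 𝓘(ℝ, S.Model) 𝓘(ℝ, V) ∞ f ∧
      ∀ x, Function.Injective (mfderiv (M := S.Space) 𝓘(ℝ, S.Model) 𝓘(ℝ, V) f x) :=
  Iff.rfl

theorem isSurjectiveSubmersion_iff {f : X → Y} : S.IsSurjectiveSubmersion T f ↔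
    Function.Surjective f ∧ S.SmoothMap T f ∧
      ∀ x, Function.Surjective
        (mfderiv (M := S.Space) (M' := T.Space) 𝓘(ℝ, S.Model) 𝓘(ℝ, T.Model) f x) :=
  Iff.rfl

theorem isDiffeomorphism_iff {f : X ≃ Y} :
    S.IsDiffeomorphism T f ↔ S.SmoothMap T f ∧ T.SmoothMap S f.symm := by
  constructor
  · rintro ⟨Φ₀, hΦ⟩
    let Φ : S.Space ≃ₘ^∞⟮𝓘(ℝ, S.Model), 𝓘(ℝ, T.Model)⟯ T.Space := Φ₀
    obtain rfl : Φ.toEquiv = f := Equiv.ext hΦ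
    exact ⟨Φ.contMDiff, Φ.symm.contMDiff⟩
  · rintro ⟨hf, hf'⟩
    let Φ : S.Space ≃ₘ^∞⟮𝓘(ℝ, S.Model), 𝓘(ℝ, T.Model)⟯ T.Space := ⟨f, hf, hf'⟩
    exact ⟨Φ, fun _ => rfl⟩

theorem IsEmbeddingInto.smoothMap_of_comp [FiniteDimensional ℝ V] {f : Y → V} {g : X → Y}
    (hf : T.IsEmbeddingInto f) (hfg : S.IsEmbeddingInto (f ∘ g)) : S.SmoothMap T g := by
  obtain ⟨f_embedding, f_smooth, f_injective⟩ := isEmbeddingInto_iff.1 hf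
  obtain ⟨fg_embedding, fg_smooth, -⟩ := isEmbeddingInto_iff.1 hfg
  exact contMDiff_of_comp_immersion (P := S.Space) f_smooth
    (fun y => hasLeftInverse_mfderiv (f_injective y))
    (f_embedding.continuous_iff.2 fg_embedding.continuous) fg_smooth (by simp)

theorem IsSurjectiveSubmersion.smoothMap_of_comp {f : X → Y} {g : Y → Z}
    (hf : S.IsSurjectiveSubmersion T f) (hgf : S.SmoothMap U (g ∘ f)) : T.SmoothMap U g := by
  obtain ⟨f_onto, f_smooth, f_surjective⟩ := isSurjectiveSubmersion_iff.1 hf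
  exact contMDiff_of_comp_submersion (M := S.Space) (N := T.Space) (P := U.Space)
    f_smooth (fun x => hasRightInverse_mfderiv (f_surjective x)) f_onto hgf (by simp)

theorem IsEmbeddingInto.unique [Nonempty X] [FiniteDimensional ℝ V] {S T : SmoothStructure X}
    {f : X → V} (hS : S.IsEmbeddingInto f) (hT : T.IsEmbeddingInto f) : S = T :=
  eq_of_smoothMap_id (hT.smoothMap_of_comp hS) (hS.smoothMap_of_comp hT)

theorem IsSurjectiveSubmersion.unique [Nonempty Y] {T U : SmoothStructure Y} {f : X → Y}
    (hT : S.IsSurjectiveSubmersion T f) (hU : S.IsSurjectiveSubmersion U f) : T = U :=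
  eq_of_smoothMap_id (hT.smoothMap_of_comp hU.2.1) (hU.smoothMap_of_comp hT.2.1)

theorem IsDiffeomorphism.unique [Nonempty Y] {T U : SmoothStructure Y} {f : X ≃ Y}
    (hT : S.IsDiffeomorphism T f) (hU : S.IsDiffeomorphism U f) : T = U := by
  rw [isDiffeomorphism_iff] at hT hU
  refine eq_of_smoothMap_id ?_ ?_
  · simpa only [Equiv.self_comp_symm] using hU.1.comp hT.2
  · simpa only [Equiv.self_comp_symm] using hT.1.comp hU.2

end Uniqueness

section Transport

variable {E H M : Type*} [NormedAddCommGroup E] [NormedSpace ℝ E] [TopologicalSpace H]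
  {I : ModelWithCorners ℝ E H} [TopologicalSpace M] [ChartedSpace H M]
  {E' H' N : Type*} [NormedAddCommGroup E'] [NormedSpace ℝ E'] [TopologicalSpace H']
  {J : ModelWithCorners ℝ E' H'} [TopologicalSpace N] [ChartedSpace H' N]

/-- The chart `e` of `X` becomes a diffeomorphism onto its image when `X` is identified with the
manifold `M` by means of the homeomorphism `F`. These are the charts of the structure transported
along `F`. -/
structure IsPullbackChart [TopologicalSpace X] (I : ModelWithCorners ℝ E H) (F : X ≃ₜ M)
    (e : OpenPartialHomeomorph X V) : Prop where
  contMDiffOn : ContMDiffOn I 𝓘(ℝ, V) ∞ (e ∘ F.symm) (F.symm ⁻¹' e.source)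
  contMDiffOn_symm : ContMDiffOn 𝓘(ℝ, V) I ∞ (F ∘ e.symm) e.target

section PullbackChart

variable [TopologicalSpace X] {F : X ≃ₜ M} {e e' : OpenPartialHomeomorph X V}

theorem IsPullbackChart.contDiffOn_trans (he : IsPullbackChart I F e)
    (he' : IsPullbackChart I F e') :
    ContDiffOn ℝ ∞ (e.symm ≫ₕ e') (e.symm ≫ₕ e').source := by
  rw [← contMDiffOn_iff_contDiffOn]
  refine (he'.contMDiffOn.comp (he.contMDiffOn_symm.mono inter_subset_left) ?_).congr ?_
  · intro v hv
    simpa using hv.2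
  · intro v _
    simp

theorem IsPullbackChart.compatible (he : IsPullbackChart I F e) (he' : IsPullbackChart I F e') :
    e.symm ≫ₕ e' ∈ contDiffGroupoid ∞ 𝓘(ℝ, V) :=
  mem_contDiffGroupoid_of_contDiffOn (he.contDiffOn_trans he') (he'.contDiffOn_trans he)

theorem exists_isPullbackChart [I.Boundaryless] [IsManifold I ∞ M] (F : X ≃ₜ M) (L : E ≃L[ℝ] V)
    (x : X) : ∃ e : OpenPartialHomeomorph X V, IsPullbackChart I F e ∧ x ∈ e.source := by
  let c := extChartAt I (F x)
  let e : OpenPartialHomeomorph X V := F.toOpenPartialHomeomorph ≫ₕ (chartAt H (F x) ≫ₕ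
    (I.toHomeomorph.toOpenPartialHomeomorph ≫ₕ L.toHomeomorph.toOpenPartialHomeomorph))
  have e_source : e.source = F ⁻¹' (chartAt H (F x)).source := by simp [e]
  have e_target : e.target = L.symm ⁻¹' c.target := by
    ext v
    simp [e, c, I.range_eq_univ]
  refine ⟨e, ⟨?_, ?_⟩, e_source ▸ mem_chart_source H (F x)⟩
  · have hc : ContMDiffOn I 𝓘(ℝ, V) ∞ (L ∘ c) (chartAt H (F x)).source :=
      L.contDiff.contMDiff.comp_contMDiffOn contMDiffOn_extChartAt
    refine (hc.mono fun y hy => ?_).congr fun y _ => ?_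
    · simpa only [e_source, mem_preimage, F.apply_symm_apply] using hy
    · simp [e, c]
  · refine ContMDiffOn.congr ((contMDiffOn_extChartAt_symm (F x)).comp
      L.symm.contDiff.contMDiff.contMDiffOn e_target.subset) fun v _ => ?_
    simp [e]

theorem isPullbackChart_of_compatible [I.Boundaryless] [IsManifold I ∞ M] (L : E ≃L[ℝ] V)
    (h : ∀ e' : OpenPartialHomeomorph X V, IsPullbackChart I F e' →
      e.symm ≫ₕ e' ∈ contDiffGroupoid ∞ 𝓘(ℝ, V) ∧ e'.symm ≫ₕ e ∈ contDiffGroupoid ∞ 𝓘(ℝ, V)) :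
    IsPullbackChart I F e := by
  constructor
  · intro y hy
    obtain ⟨e', he', hy'⟩ := exists_isPullbackChart (I := I) F L (F.symm y)
    have near : ∀ᶠ z in 𝓝 y, F.symm z ∈ e'.source :=
      F.symm.continuous.continuousAt.eventually (e'.open_source.mem_nhds hy')
    have e'y_mem : e' (F.symm y) ∈ (e'.symm ≫ₕ e).source :=
      ⟨e'.map_source hy', by simpa [e'.left_inv hy'] using hy⟩
    have he := (contMDiffOn_of_mem_contDiffGroupoid (h e' he').2).contMDiffAt
      ((e'.symm ≫ₕ e).open_source.mem_nhds e'y_mem)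
    refine ((he.comp y (he'.contMDiffOn.contMDiffAt near)).congr_of_eventuallyEq ?_)
      |>.contMDiffWithinAt
    filter_upwards [near] with z hz
    simp [e'.left_inv hz]
  · intro v hv
    obtain ⟨e', he', hv'⟩ := exists_isPullbackChart (I := I) F L (e.symm v)
    have near : (e.symm ≫ₕ e').source ∈ 𝓝 v := (e.symm ≫ₕ e').open_source.mem_nhds ⟨hv, hv'⟩
    have he := (contMDiffOn_of_mem_contDiffGroupoid (h e' he').1).contMDiffAt near
    have he'_symm := he'.contMDiffOn_symm.contMDiffAt (e'.open_target.mem_nhds (e'.map_source hv'))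
    refine ((ContMDiffAt.comp v he'_symm he).congr_of_eventuallyEq ?_).contMDiffWithinAt
    filter_upwards [near] with z hz
    exact congrArg F (e'.left_inv hz.2).symm

end PullbackChart

section OfEquiv

variable (I) [FiniteDimensional ℝ E] [I.Boundaryless] [IsManifold I ∞ M] [T2Space M]
  [SecondCountableTopology M] [FiniteDimensional ℝ E'] [J.Boundaryless] [IsManifold J ∞ N]
  [T2Space N] [SecondCountableTopology N]

/-- The smooth structure on the set `X` that makes the bijection `f` onto the manifold `M` a
diffeomorphism. -/
noncomputable def ofEquiv (f : X ≃ M) : SmoothStructure X :=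
  letI : TopologicalSpace X := TopologicalSpace.induced f inferInstance
  let F : X ≃ₜ M := f.toHomeomorphOfIsInducing ⟨rfl⟩
  { dim := Module.finrank ℝ E
    t2 := F.symm.t2Space
    secondCountable := F.secondCountableTopology
    atlas := {e | IsPullbackChart I F e}
    cover := exists_isPullbackChart F toEuclidean
    compatible := fun _ he _ he' => he.compatible he'
    maximal := fun _ h => isPullbackChart_of_compatible toEuclidean h }

theorem dim_ofEquiv (f : X ≃ M) : (ofEquiv I f).dim = Module.finrank ℝ E := rfl

/-- The bijection `f` as a homeomorphism from `X`, with the structure `ofEquiv I f`, onto `M`. -/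
noncomputable def ofEquivHomeomorph (f : X ≃ M) : (ofEquiv I f).Space ≃ₜ M :=
  letI : TopologicalSpace X := TopologicalSpace.induced f inferInstance
  f.toHomeomorphOfIsInducing ⟨rfl⟩

theorem isPullbackChart_chartAt (f : X ≃ M) (x : (ofEquiv I f).Space) :
    IsPullbackChart I (ofEquivHomeomorph I f) (chartAt (ofEquiv I f).Model x) :=
  chart_mem_atlas (ofEquiv I f).Model x

/-- The bijection `f` as a diffeomorphism from `X`, with the structure `ofEquiv I f`, onto `M`. -/
noncomputable def ofEquivDiffeomorph (f : X ≃ M) :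
    (ofEquiv I f).Space ≃ₘ^∞⟮𝓘(ℝ, (ofEquiv I f).Model), I⟯ M where
  toEquiv := (ofEquivHomeomorph I f).toEquiv
  contMDiff_toFun x := by
    let e := chartAt (ofEquiv I f).Model x
    have near := e.open_source.mem_nhds (mem_chart_source _ x)
    have hf := (isPullbackChart_chartAt I f x).contMDiffOn_symm.contMDiffAt
      (e.open_target.mem_nhds (mem_chart_target _ x))
    refine (hf.comp x (contMDiffOn_chart.contMDiffAt near)).congr_of_eventuallyEq ?_
    filter_upwards [near] with z hz
    exact congrArg f (e.left_inv hz).symm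
  contMDiff_invFun y := by
    let F := ofEquivHomeomorph I f
    let e := chartAt (ofEquiv I f).Model (F.symm y)
    have near : ∀ᶠ z in 𝓝 y, F.symm z ∈ e.source :=
      F.symm.continuous.continuousAt.eventually (e.open_source.mem_nhds (mem_chart_source _ _))
    have he := contMDiffOn_chart_symm (I := 𝓘(ℝ, (ofEquiv I f).Model)) (n := ∞)
      |>.contMDiffAt (e.open_target.mem_nhds (mem_chart_target _ _))
    refine (ContMDiffAt.comp y he ((isPullbackChart_chartAt I f _).contMDiffOn.contMDiffAt near))
      |>.congr_of_eventuallyEq ?_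
    filter_upwards [near] with z hz
    exact (e.left_inv hz).symm

theorem isEmbeddingInto_ofEquiv {W : Type*} [NormedAddCommGroup W] [NormedSpace ℝ W] (f : X ≃ M)
    {F : M → W} (hF : IsEmbedding F) (hF_smooth : ContMDiff I 𝓘(ℝ, W) ∞ F)
    (hF_inj : ∀ y, Function.Injective (mfderiv I 𝓘(ℝ, W) F y)) :
    (ofEquiv I f).IsEmbeddingInto (F ∘ f) := by
  let Φ := ofEquivDiffeomorph I f
  rw [isEmbeddingInto_iff]
  refine ⟨hF.comp (ofEquivHomeomorph I f).isEmbedding, hF_smooth.comp Φ.contMDiff, fun x => ?_⟩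
  have chain : mfderiv 𝓘(ℝ, (ofEquiv I f).Model) 𝓘(ℝ, W) (F ∘ Φ) x = _ :=
    mfderiv_comp x (hF_smooth.mdifferentiable (by simp) _) (Φ.mdifferentiable (by simp) x)
  exact chain ▸ (hF_inj (Φ x)).comp (Φ.mfderivToContinuousLinearEquiv (by simp) x).injective

theorem isSurjectiveSubmersion_ofEquiv (f : X ≃ M) (g : Y ≃ N) {p : M → N}
    (hp_onto : Function.Surjective p) (hp_smooth : ContMDiff I J ∞ p)
    (hp_surj : ∀ y, Function.Surjective (mfderiv I J p y)) :
    (ofEquiv I f).IsSurjectiveSubmersion (ofEquiv J g) (g.symm ∘ p ∘ f) := by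
  let Φ := ofEquivDiffeomorph I f
  let Ψ := ofEquivDiffeomorph J g
  have pΦ_smooth : ContMDiff 𝓘(ℝ, (ofEquiv I f).Model) J ∞ (p ∘ Φ) := hp_smooth.comp Φ.contMDiff
  rw [isSurjectiveSubmersion_iff]
  refine ⟨g.symm.surjective.comp (hp_onto.comp f.surjective), Ψ.symm.contMDiff.comp pΦ_smooth,
    fun x => ?_⟩
  have chain : mfderiv 𝓘(ℝ, (ofEquiv I f).Model) J (p ∘ Φ) x = _ :=
    mfderiv_comp x (hp_smooth.mdifferentiable (by simp) _) (Φ.mdifferentiable (by simp) x)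
  have chain' : mfderiv 𝓘(ℝ, (ofEquiv I f).Model) 𝓘(ℝ, (ofEquiv J g).Model) (Ψ.symm ∘ p ∘ Φ) x =
      _ :=
    mfderiv_comp x (Ψ.symm.mdifferentiable (by simp) _) (pΦ_smooth.mdifferentiable (by simp) x)
  have pΦ_surj : Function.Surjective (mfderiv 𝓘(ℝ, (ofEquiv I f).Model) J (p ∘ Φ) x) :=
    chain ▸ (hp_surj (Φ x)).comp (Φ.mfderivToContinuousLinearEquiv (by simp) x).surjective
  exact chain' ▸
    (Ψ.symm.mfderivToContinuousLinearEquiv (by simp) (p (Φ x))).surjective.comp pΦ_surj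

end OfEquiv

theorem exists_isDiffeomorphism (S : SmoothStructure X) (f : X ≃ Y) :
    ∃ T : SmoothStructure Y, S.IsDiffeomorphism T f := by
  let g : Y ≃ S.Space := f.symm
  let Φ := ofEquivDiffeomorph 𝓘(ℝ, S.Model) g
  exact ⟨ofEquiv 𝓘(ℝ, S.Model) g, isDiffeomorphism_iff.2 ⟨Φ.symm.contMDiff, Φ.contMDiff⟩⟩

end Transport

end SmoothStructure

/-! ### The regular product with a linear function -/

theorem HasRegularExpansion.eq_regularSeries {f : QBall → ℍ[ℝ]} {a : ℕ → ℍ[ℝ]}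
    (ha : HasRegularExpansion f a) : regularSeries a = f :=
  funext fun q => (ha q).tsum_eq

/-- The coefficients of the power series of `l_{(a,b)}`. -/
noncomputable def linearCoeff (a b : ℍ[ℝ]) : ℕ → ℍ[ℝ]
  | 0 => b
  | 1 => a
  | _ + 2 => 0

theorem hasRegularExpansion_linearFun (a b : ℍ[ℝ]) :
    HasRegularExpansion (linearFun a b) (linearCoeff a b) := by
  intro q
  have head : linearFun a b q = ∑ n ∈ Finset.range 2, (q : ℍ[ℝ]) ^ n * linearCoeff a b n := by
    simp [Finset.sum_range_succ, linearCoeff, linearFun, add_comm]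
  rw [head]
  refine hasSum_sum_of_ne_finset_zero fun n hn => ?_
  obtain ⟨k, rfl⟩ : ∃ k, n = k + 2 := ⟨n - 2, by grind⟩
  rw [linearCoeff, mul_zero]

theorem regularConj_linearFun (a b : ℍ[ℝ]) :
    regularConj (linearFun a b) = linearFun (star a) (star b) := by
  have star_coeff : (fun n => star (linearCoeff a b n)) = linearCoeff (star a) (star b) := by
    funext n
    match n with
    | 0 => rfl
    | 1 => rfl
    | _ + 2 => exact star_zero _
  rw [regularConj, (hasRegularExpansion_linearFun a b).regularCoeff_eq, star_coeff,
    (hasRegularExpansion_linearFun _ _).eq_regularSeries]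

/-- The coefficients of `f * l_{(a,b)}`, where `e` is the sequence of coefficients of `f`. -/
noncomputable def mulLinearCoeff (e : ℕ → ℍ[ℝ]) (a b : ℍ[ℝ]) : ℕ → ℍ[ℝ]
  | 0 => e 0 * b
  | n + 1 => e (n + 1) * b + e n * a

theorem sum_mul_linearCoeff (e : ℕ → ℍ[ℝ]) (a b : ℍ[ℝ]) (n : ℕ) :
    ∑ k ∈ Finset.range (n + 1), e k * linearCoeff a b (n - k) = mulLinearCoeff e a b n := by
  match n with
  | 0 => simp [linearCoeff, mulLinearCoeff]
  | n + 1 =>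
    have low : ∑ k ∈ Finset.range n, e k * linearCoeff a b (n + 1 - k) = 0 := by
      refine Finset.sum_eq_zero fun k hk => ?_
      obtain ⟨j, hj⟩ : ∃ j, n + 1 - k = j + 2 := ⟨n - 1 - k, by grind⟩
      rw [hj, linearCoeff, mul_zero]
    rw [Finset.sum_range_succ, Finset.sum_range_succ, low, Nat.sub_self, Nat.add_sub_cancel_left]
    simp only [linearCoeff, mulLinearCoeff]
    abel

theorem hasSum_mulLinearCoeff {e : ℕ → ℍ[ℝ]} {q y : ℍ[ℝ]} (h : HasSum (fun n => q ^ n * e n) y)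
    (a b : ℍ[ℝ]) : HasSum (fun n => q ^ n * mulLinearCoeff e a b n) (y * b + q * y * a) := by
  have shifted : HasSum (fun n => if n = 0 then 0 else q ^ n * e (n - 1) * a) (q * y * a) := by
    rw [← hasSum_nat_add_iff' 1]
    simpa [pow_succ', mul_assoc] using (h.mul_left q).mul_right a
  refine ((h.mul_right b).add shifted).congr_fun fun n => ?_
  match n with
  | 0 => simp [mulLinearCoeff]
  | n + 1 => simp [mulLinearCoeff, mul_add, mul_assoc]

theorem HasRegularExpansion.starProd_linearFun_eq {f : QBall → ℍ[ℝ]} {e : ℕ → ℍ[ℝ]}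
    (h : HasRegularExpansion f e) (a b : ℍ[ℝ]) :
    starProd f (linearFun a b) = fun q : QBall => f q * b + q * f q * a := by
  simp only [starProd, h.regularCoeff_eq, (hasRegularExpansion_linearFun a b).regularCoeff_eq,
    sum_mul_linearCoeff]
  exact funext fun q => (hasSum_mulLinearCoeff (h q) a b).tsum_eq

theorem HasRegularExpansion.starProd_linearFun {f : QBall → ℍ[ℝ]} {e : ℕ → ℍ[ℝ]}
    (h : HasRegularExpansion f e) (a b : ℍ[ℝ]) :
    HasRegularExpansion (starProd f (linearFun a b)) (mulLinearCoeff e a b) := by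
  intro q
  simpa only [h.starProd_linearFun_eq] using hasSum_mulLinearCoeff (h q) a b

/-! ### The regular reciprocal of a linear function -/

theorem symmetrization_linearFun (c d : ℍ[ℝ]) (q : QBall) :
    symmetrization (linearFun c d) q =
      d * star d + q * (c * star d + d * star c) + q * (q * (c * star c)) := by
  rw [symmetrization, regularConj_linearFun,
    (hasRegularExpansion_linearFun c d).starProd_linearFun_eq]
  simp only [linearFun]
  noncomm_ring

theorem commute_symmetrization_linearFun (c d : ℍ[ℝ]) (q : QBall) :
    Commute (q : ℍ[ℝ]) (symmetrization (linearFun c d) q) := by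
  have real (t : ℝ) : Commute (q : ℍ[ℝ]) t := (Quaternion.coe_commutes t _).symm
  have self : Commute (q : ℍ[ℝ]) q := Commute.refl _
  have middle : c * star d + d * star c = ((2 * (c * star d).re : ℝ) : ℍ[ℝ]) := by
    rw [← Quaternion.self_add_star', star_mul, star_star]
  rw [symmetrization_linearFun, middle, Quaternion.self_mul_star, Quaternion.self_mul_star]
  exact ((real _).add_right (self.mul_right (real _))).add_right
    (self.mul_right (self.mul_right (real _)))

theorem symmetrization_linearFun_eq_regularConj (c d : ℍ[ℝ]) (q : QBall) :
    symmetrization (linearFun c d) q = regularConj (linearFun c d) q * d +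
      q * regularConj (linearFun c d) q * c := by
  have middle : c * star d + d * star c = star c * d + star d * c := by
    ext <;> simp <;> ring
  rw [symmetrization_linearFun, regularConj_linearFun, linearFun, middle,
    ← star_comm_self' c, ← star_comm_self' d]
  noncomm_ring

theorem eq_of_mul_add_mul_mul_eq {c d q x y : ℍ[ℝ]} (h : ‖c‖ < ‖d‖) (hq : ‖q‖ < 1)
    (hxy : x * d + q * x * c = y * d + q * y * c) : x = y := by
  have cancel : (x - y) * d = -(q * (x - y) * c) := by
    rw [sub_mul, mul_sub, sub_mul, neg_sub, sub_eq_sub_iff_add_eq_add, hxy, add_comm]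
  have norm_eq : ‖x - y‖ * ‖d‖ = ‖q‖ * ‖x - y‖ * ‖c‖ := by
    simpa only [norm_mul, norm_neg] using congrArg norm cancel
  by_contra hne
  have pos : 0 < ‖x - y‖ := norm_sub_pos_iff.2 hne
  have : ‖q‖ * ‖c‖ < ‖d‖ := (mul_le_of_le_one_left (norm_nonneg c) hq.le).trans_lt h
  nlinarith

theorem add_mul_ne_zero {c d p : ℍ[ℝ]} (h : ‖c‖ < ‖d‖) (hp : ‖p‖ < 1) : d + p * c ≠ 0 := fun h0 =>
  one_ne_zero (eq_of_mul_add_mul_mul_eq h hp (x := 1) (y := 0) (by simpa using h0))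

theorem regularConj_linearFun_ne_zero {c d : ℍ[ℝ]} (h : ‖c‖ < ‖d‖) (q : QBall) :
    regularConj (linearFun c d) q ≠ 0 := by
  rw [regularConj_linearFun, linearFun, add_comm]
  exact add_mul_ne_zero (by simpa only [norm_star] using h) (mem_ball_zero_iff.1 q.2)

theorem exists_regularReciprocal_linearFun {c d : ℍ[ℝ]} (h : ‖c‖ < ‖d‖) (q : QBall) :
    ∃ p : ℍ[ℝ], ‖p‖ = ‖(q : ℍ[ℝ])‖ ∧
      regularReciprocal (linearFun c d) q = (d + p * c)⁻¹ ∧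
      q * regularReciprocal (linearFun c d) q = regularReciprocal (linearFun c d) q * p := by
  set w := regularConj (linearFun c d) q
  have w_ne : w ≠ 0 := regularConj_linearFun_ne_zero h q
  have w_mul : w * (w⁻¹ * q * w) = q * w := by rw [mul_assoc, mul_inv_cancel_left₀ w_ne]
  have factor : symmetrization (linearFun c d) q = w * (d + w⁻¹ * q * w * c) := by
    rw [symmetrization_linearFun_eq_regularConj, mul_add w, ← mul_assoc w _ c, w_mul]
  refine ⟨w⁻¹ * q * w, ?_, ?_, ?_⟩
  · rw [norm_mul, norm_mul, norm_inv, mul_right_comm, inv_mul_cancel₀ (norm_ne_zero_iff.2 w_ne),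
      one_mul]
  · rw [regularReciprocal, factor, mul_inv_rev, inv_mul_cancel_right₀ w_ne]
  · rw [regularReciprocal, ← mul_assoc, (commute_symmetrization_linearFun c d q).inv_right₀.eq,
      mul_assoc, mul_assoc, w_mul]

theorem regularReciprocal_linearFun_mul_add {c d : ℍ[ℝ]} (h : ‖c‖ < ‖d‖) (q : QBall) :
    regularReciprocal (linearFun c d) q * d + q * regularReciprocal (linearFun c d) q * c = 1 := by
  obtain ⟨p, norm_p, value, twist⟩ := exists_regularReciprocal_linearFun h q
  have hp : ‖p‖ < 1 := norm_p ▸ mem_ball_zero_iff.1 q.2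
  rw [twist, mul_assoc, ← mul_add, value, inv_mul_cancel₀ (add_mul_ne_zero h hp)]

/-- The coefficients of `l_{(c,d)}^{-*}`. -/
noncomputable def reciprocalCoeff (c d : ℍ[ℝ]) (n : ℕ) : ℍ[ℝ] := d⁻¹ * (-(c * d⁻¹)) ^ n

theorem summable_reciprocalCoeff {c d q : ℍ[ℝ]} (h : ‖c‖ < ‖d‖) (hq : ‖q‖ < 1) :
    Summable fun n => q ^ n * reciprocalCoeff c d n := by
  have ratio : ‖q‖ * ‖-(c * d⁻¹)‖ < 1 := by
    rw [norm_neg, norm_mul, norm_inv, ← div_eq_mul_inv]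
    exact mul_lt_one_of_nonneg_of_lt_one_left (norm_nonneg q) hq
      ((div_lt_one ((norm_nonneg c).trans_lt h)).2 h).le
  refine .of_norm_bounded (g := fun n => ‖d⁻¹‖ * (‖q‖ * ‖-(c * d⁻¹)‖) ^ n)
    ((summable_geometric_of_lt_one (by positivity) ratio).mul_left _) fun n => le_of_eq ?_
  simp only [reciprocalCoeff, norm_mul, norm_pow, mul_pow]
  ring

theorem mulLinearCoeff_reciprocalCoeff (c : ℍ[ℝ]) {d : ℍ[ℝ]} (hd : d ≠ 0) :
    mulLinearCoeff (reciprocalCoeff c d) c d = Pi.single 0 1 := by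
  funext n
  match n with
  | 0 => simp [mulLinearCoeff, reciprocalCoeff, hd]
  | n + 1 => simp [mulLinearCoeff, reciprocalCoeff, pow_succ, mul_assoc, hd]

theorem hasRegularExpansion_regularReciprocal {c d : ℍ[ℝ]} (h : ‖c‖ < ‖d‖) :
    HasRegularExpansion (regularReciprocal (linearFun c d)) (reciprocalCoeff c d) := by
  intro q
  have hq : ‖(q : ℍ[ℝ])‖ < 1 := mem_ball_zero_iff.1 q.2
  have hd : d ≠ 0 := norm_pos_iff.1 ((norm_nonneg c).trans_lt h)
  obtain ⟨y, hy⟩ := summable_reciprocalCoeff h hq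
  have y_mul_add : y * d + q * y * c = 1 := by
    have sum := hasSum_mulLinearCoeff hy c d
    rw [mulLinearCoeff_reciprocalCoeff c hd] at sum
    refine sum.unique ?_
    convert hasSum_single (f := fun n => (q : ℍ[ℝ]) ^ n * (Pi.single 0 1 : ℕ → ℍ[ℝ]) n) 0 ?_ using 1
    · simp
    · intro n hn
      simp [hn]
  exact eq_of_mul_add_mul_mul_eq h hq
    (y_mul_add.trans (regularReciprocal_linearFun_mul_add h q).symm) ▸ hy

/-! ### The group `Sp(1,1)` -/

theorem mem_Sp11_iff_norm {A : Matrix (Fin 2) (Fin 2) ℍ[ℝ]} :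
    A ∈ Sp11 ↔ ‖A 0 0‖ ^ 2 = 1 + ‖A 1 0‖ ^ 2 ∧ star (A 0 0) * A 0 1 = star (A 1 0) * A 1 1 ∧
      ‖A 1 1‖ ^ 2 = 1 + ‖A 0 1‖ ^ 2 := by
  have gram : Aᴴ * I11 * A = !![((‖A 0 0‖ ^ 2 - ‖A 1 0‖ ^ 2 : ℝ) : ℍ[ℝ]),
      star (A 0 0) * A 0 1 - star (A 1 0) * A 1 1;
      star (star (A 0 0) * A 0 1 - star (A 1 0) * A 1 1),
      ((‖A 0 1‖ ^ 2 - ‖A 1 1‖ ^ 2 : ℝ) : ℍ[ℝ])] := by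
    ext i j : 1
    fin_cases i <;> fin_cases j <;>
      simp [I11, Matrix.mul_apply, sq, ← Quaternion.normSq_eq_norm_mul_self,
        ← Quaternion.star_mul_self, sub_eq_add_neg]
  have gram_eq : I11 = !![((1 : ℝ) : ℍ[ℝ]), 0; 0, ((-1 : ℝ) : ℍ[ℝ])] := by
    simp [I11]
  rw [mem_Sp11, gram]
  conv_lhs => rhs; rw [gram_eq]
  rw [← Matrix.ext_iff]
  simp only [Fin.forall_fin_two, Matrix.of_apply, Matrix.cons_val', Matrix.cons_val_zero,
    Matrix.cons_val_one, Matrix.cons_val_fin_one, Quaternion.coe_inj, star_eq_zero, sub_eq_zero]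
  grind

namespace Sp11

variable (A : Sp11)

theorem coe_inv : (A⁻¹).1 =
    !![star (A.1 0 0), -star (A.1 1 0); -star (A.1 0 1), star (A.1 1 1)] := by
  change I11 * A.1ᴴ * I11 = _
  ext i j : 1
  fin_cases i <;> fin_cases j <;> simp [I11, Matrix.mul_apply, Matrix.vecMul, dotProduct]

theorem norm_sq_apply_zero_zero : ‖A.1 0 0‖ ^ 2 = 1 + ‖A.1 0 1‖ ^ 2 := by
  simpa [coe_inv] using (mem_Sp11_iff_norm.1 A⁻¹.2).1

theorem norm_sq_apply_one_one : ‖A.1 1 1‖ ^ 2 = 1 + ‖A.1 0 1‖ ^ 2 :=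
  (mem_Sp11_iff_norm.1 A.2).2.2

theorem norm_sq_apply_one_one' : ‖A.1 1 1‖ ^ 2 = 1 + ‖A.1 1 0‖ ^ 2 := by
  simpa [coe_inv] using (mem_Sp11_iff_norm.1 A⁻¹.2).2.2

theorem apply_mul_star_apply : A.1 0 0 * star (A.1 1 0) = A.1 0 1 * star (A.1 1 1) := by
  simpa [coe_inv] using (mem_Sp11_iff_norm.1 A⁻¹.2).2.1

theorem norm_apply_zero_one_lt : ‖A.1 0 1‖ < ‖A.1 1 1‖ := by
  nlinarith [norm_sq_apply_one_one A, norm_nonneg (A.1 1 1)]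

theorem norm_apply_one_zero_lt : ‖A.1 1 0‖ < ‖A.1 1 1‖ := by
  nlinarith [norm_sq_apply_one_one' A, norm_nonneg (A.1 1 1)]

theorem norm_apply_zero_zero : ‖A.1 0 0‖ = ‖A.1 1 1‖ := by
  rw [← sq_eq_sq₀ (norm_nonneg _) (norm_nonneg _), norm_sq_apply_zero_zero, norm_sq_apply_one_one]

theorem apply_one_one_ne_zero : A.1 1 1 ≠ 0 :=
  norm_pos_iff.1 ((norm_nonneg _).trans_lt (norm_apply_zero_one_lt A))

end Sp11

/-- The unit sphere `S³` of the quaternions, that is, `Sp(1)`. -/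
abbrev QSphere : Set ℍ[ℝ] := Metric.sphere (0 : ℍ[ℝ]) 1

namespace Sp11

/-- The matrix `u I₂`. -/
noncomputable def scalar (u : QSphere) : Sp11 where
  val := Matrix.diagonal fun _ => u
  property := mem_Sp11_iff_norm.2 (by simp)

theorem mem_Sp1I2_iff_exists_scalar {A : Sp11} : A ∈ Sp1I2 ↔ ∃ u, A = scalar u :=
  ⟨fun ⟨u, norm_u, hA⟩ => ⟨⟨u, mem_sphere_zero_iff_norm.2 norm_u⟩, Subtype.ext hA⟩,
    fun ⟨u, hA⟩ => ⟨u, norm_eq_of_mem_sphere u, congrArg Subtype.val hA⟩⟩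

theorem mul_inv_mem_Sp1I2_iff {A B : Sp11} : B * A⁻¹ ∈ Sp1I2 ↔ ∃ u, B = scalar u * A := by
  simp only [mem_Sp1I2_iff_exists_scalar, mul_inv_eq_iff_eq_mul]

theorem inv_mul_mem_Sp1I2_iff {A B : Sp11} : A⁻¹ * B ∈ Sp1I2 ↔ ∃ u, B = A * scalar u := by
  simp only [mem_Sp1I2_iff_exists_scalar, inv_mul_eq_iff_eq_mul]

theorem scalar_mul_apply (u : QSphere) (A : Sp11) (i j : Fin 2) :
    (scalar u * A).1 i j = u * A.1 i j :=
  Matrix.diagonal_mul _ _ i j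

theorem mul_scalar_apply (A : Sp11) (u : QSphere) (i j : Fin 2) :
    (A * scalar u).1 i j = A.1 i j * u :=
  Matrix.mul_diagonal _ _ i j

theorem norm_add_mul_sq (A : Sp11) (p : ℍ[ℝ]) :
    ‖A.1 1 1 + p * A.1 0 1‖ ^ 2 + ‖p‖ ^ 2 = 1 + ‖A.1 1 0 + p * A.1 0 0‖ ^ 2 := by
  have cross : A.1 1 1 * star (p * A.1 0 1) = A.1 1 0 * star (p * A.1 0 0) := by
    have := congrArg star (apply_mul_star_apply A)
    simp only [star_mul, star_star] at this
    simp only [star_mul, ← mul_assoc, this]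
  rw [norm_add_sq_real, norm_add_sq_real, Quaternion.inner_def, Quaternion.inner_def, cross,
    norm_mul, norm_mul, mul_pow, mul_pow, norm_sq_apply_one_one', norm_sq_apply_zero_zero]
  ring

end Sp11

/-! ### Regular Möbius transformations -/

theorem regularMobius_apply (A : Sp11) (q : QBall) :
    regularMobius A q = regularReciprocal (linearFun (A.1 0 1) (A.1 1 1)) q * A.1 1 0 +
      q * regularReciprocal (linearFun (A.1 0 1) (A.1 1 1)) q * A.1 0 0 := by
  rw [regularMobius,
    (hasRegularExpansion_regularReciprocal (Sp11.norm_apply_zero_one_lt A)).starProd_linearFun_eq]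

theorem norm_regularMobius_lt_one (A : Sp11) (q : QBall) : ‖regularMobius A q‖ < 1 := by
  obtain ⟨p, norm_p, value, twist⟩ :=
    exists_regularReciprocal_linearFun (Sp11.norm_apply_zero_one_lt A) q
  have hp : ‖p‖ < 1 := norm_p ▸ mem_ball_zero_iff.1 q.2
  have mobius_eq : regularMobius A q =
      (A.1 1 1 + p * A.1 0 1)⁻¹ * (A.1 1 0 + p * A.1 0 0) := by
    rw [regularMobius_apply, twist, value, mul_add, mul_assoc]
  rw [mobius_eq, norm_mul, norm_inv, ← div_eq_inv_mul,
    div_lt_one (norm_pos_iff.2 (add_mul_ne_zero (Sp11.norm_apply_zero_one_lt A) hp))]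
  nlinarith [Sp11.norm_add_mul_sq A p, norm_nonneg p, norm_nonneg (A.1 1 1 + p * A.1 0 1)]

theorem regularMobius_scalar_mul (u : QSphere) (A : Sp11) :
    regularMobius (Sp11.scalar u * A) = regularMobius A := by
  funext q
  set R := regularReciprocal (linearFun (A.1 0 1) (A.1 1 1)) q with hR
  set R' := regularReciprocal
    (linearFun ((Sp11.scalar u * A).1 0 1) ((Sp11.scalar u * A).1 1 1)) q with hR'
  have R'_mul_u : R' * u = R := by
    refine eq_of_mul_add_mul_mul_eq (Sp11.norm_apply_zero_one_lt A) (mem_ball_zero_iff.1 q.2) ?_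
    have relation : R' * (u * A.1 1 1) + q * R' * (u * A.1 0 1) = 1 := by
      rw [← Sp11.scalar_mul_apply, ← Sp11.scalar_mul_apply]
      exact regularReciprocal_linearFun_mul_add (Sp11.norm_apply_zero_one_lt _) q
    rw [hR, regularReciprocal_linearFun_mul_add (Sp11.norm_apply_zero_one_lt A)]
    simpa only [mul_assoc] using relation
  rw [regularMobius_apply, regularMobius_apply, ← hR, ← hR', ← R'_mul_u]
  simp only [Sp11.scalar_mul_apply, mul_assoc]

theorem mulLinearCoeff_reciprocalCoeff_zero (a b c d : ℍ[ℝ]) :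
    mulLinearCoeff (reciprocalCoeff c d) a b 0 = d⁻¹ * b := by
  rw [mulLinearCoeff, reciprocalCoeff, pow_zero, mul_one]

theorem mulLinearCoeff_reciprocalCoeff_succ (a b c d : ℍ[ℝ]) (n : ℕ) :
    mulLinearCoeff (reciprocalCoeff c d) a b (n + 1) =
      (-(d⁻¹ * c)) ^ n * (d⁻¹ * a - d⁻¹ * c * (d⁻¹ * b)) := by
  have semiconj : d⁻¹ * (-(c * d⁻¹)) ^ n = (-(d⁻¹ * c)) ^ n * d⁻¹ :=
    (SemiconjBy.pow_right (show SemiconjBy d⁻¹ (-(c * d⁻¹)) (-(d⁻¹ * c)) by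
      simp [SemiconjBy, mul_assoc]) n).eq
  rw [mulLinearCoeff, reciprocalCoeff, reciprocalCoeff, pow_succ, ← mul_assoc, semiconj]
  noncomm_ring

theorem hasRegularExpansion_regularMobius (A : Sp11) : HasRegularExpansion (regularMobius A)
    (mulLinearCoeff (reciprocalCoeff (A.1 0 1) (A.1 1 1)) (A.1 0 0) (A.1 1 0)) :=
  (hasRegularExpansion_regularReciprocal (Sp11.norm_apply_zero_one_lt A)).starProd_linearFun _ _

theorem Sp11.inv_mul_sub_ne_zero (A : Sp11) :
    (A.1 1 1)⁻¹ * A.1 0 0 - (A.1 1 1)⁻¹ * A.1 0 1 * ((A.1 1 1)⁻¹ * A.1 1 0) ≠ 0 := by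
  have hd : 0 < ‖A.1 1 1‖ := norm_pos_iff.2 (apply_one_one_ne_zero A)
  intro h
  have norm_eq := congrArg norm (sub_eq_zero.1 h)
  simp only [norm_mul, norm_inv, norm_apply_zero_zero, inv_mul_cancel₀ hd.ne',
    ← div_eq_inv_mul] at norm_eq
  exact norm_eq.not_gt <| mul_lt_one_of_nonneg_of_lt_one_left (by positivity)
    ((div_lt_one hd).2 (norm_apply_zero_one_lt A)) ((div_lt_one hd).2 (norm_apply_one_zero_lt A)).le

theorem Sp11.exists_eq_scalar_mul {A B : Sp11}
    (h : ∀ i j, (A.1 1 1)⁻¹ * A.1 i j = (B.1 1 1)⁻¹ * B.1 i j) : ∃ u, B = scalar u * A := by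
  have hA := norm_pos_iff.2 (apply_one_one_ne_zero A)
  have hB := norm_pos_iff.2 (apply_one_one_ne_zero B)
  have ratio_eq : ‖A.1 0 1‖ * ‖B.1 1 1‖ = ‖B.1 0 1‖ * ‖A.1 1 1‖ := by
    have := congrArg norm (h 0 1)
    rwa [norm_mul, norm_mul, norm_inv, norm_inv, ← div_eq_inv_mul, ← div_eq_inv_mul,
      div_eq_div_iff hA.ne' hB.ne'] at this
  have norm_eq : ‖A.1 1 1‖ = ‖B.1 1 1‖ := by
    refine (sq_eq_sq₀ hA.le hB.le).1 ?_
    linear_combination norm_sq_apply_one_one A * ‖B.1 1 1‖ ^ 2 -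
      norm_sq_apply_one_one B * ‖A.1 1 1‖ ^ 2 +
      (‖A.1 0 1‖ * ‖B.1 1 1‖ + ‖B.1 0 1‖ * ‖A.1 1 1‖) * ratio_eq
  have norm_u : ‖B.1 1 1 * (A.1 1 1)⁻¹‖ = 1 := by
    rw [norm_mul, norm_inv, norm_eq, mul_inv_cancel₀ hB.ne']
  refine ⟨⟨_, mem_sphere_zero_iff_norm.2 norm_u⟩, Subtype.ext (Matrix.ext fun i j => ?_)⟩
  rw [scalar_mul_apply, mul_assoc, h, mul_inv_cancel_left₀ (apply_one_one_ne_zero B)]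

theorem inv_mul_apply_eq_of_regularMobius_eq {A B : Sp11} (h : regularMobius A = regularMobius B)
    (i j : Fin 2) : (A.1 1 1)⁻¹ * A.1 i j = (B.1 1 1)⁻¹ * B.1 i j := by
  have expansion_B := hasRegularExpansion_regularMobius B
  rw [← h] at expansion_B
  have coeff_eq (n : ℕ) := congrFun ((hasRegularExpansion_regularMobius A).unique expansion_B) n
  have coeff_zero := coeff_eq 0
  have coeff_one := coeff_eq (0 + 1)
  have coeff_two := coeff_eq (1 + 1)
  simp only [mulLinearCoeff_reciprocalCoeff_zero] at coeff_zero
  simp only [mulLinearCoeff_reciprocalCoeff_succ, pow_zero, one_mul] at coeff_one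
  simp only [mulLinearCoeff_reciprocalCoeff_succ, pow_one, ← coeff_one] at coeff_two
  have h01 : (A.1 1 1)⁻¹ * A.1 0 1 = (B.1 1 1)⁻¹ * B.1 0 1 :=
    neg_injective (mul_right_cancel₀ (Sp11.inv_mul_sub_ne_zero A) coeff_two)
  have h00 : (A.1 1 1)⁻¹ * A.1 0 0 = (B.1 1 1)⁻¹ * B.1 0 0 := by
    rwa [h01, coeff_zero, sub_left_inj] at coeff_one
  have h11 : (A.1 1 1)⁻¹ * A.1 1 1 = (B.1 1 1)⁻¹ * B.1 1 1 := by
    rw [inv_mul_cancel₀ (Sp11.apply_one_one_ne_zero A),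
      inv_mul_cancel₀ (Sp11.apply_one_one_ne_zero B)]
  fin_cases i <;> fin_cases j
  exacts [h00, h01, coeff_zero, h11]

theorem regularMobius_eq_iff {A B : Sp11} :
    regularMobius A = regularMobius B ↔ B * A⁻¹ ∈ Sp1I2 := by
  rw [Sp11.mul_inv_mem_Sp1I2_iff]
  constructor
  · exact fun h => Sp11.exists_eq_scalar_mul (inv_mul_apply_eq_of_regularMobius_eq h)
  · rintro ⟨u, rfl⟩
    exact (regularMobius_scalar_mul u A).symm

/-! ### Polar coordinates on `Sp(1,1)` -/

instance fact_finrank_quaternion : Fact (Module.finrank ℝ ℍ[ℝ] = 3 + 1) :=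
  ⟨Quaternion.finrank_eq_four⟩

instance starModule_quaternion : StarModule ℝ ℍ[ℝ] := ⟨Quaternion.star_smul⟩

/-- The length `√(1 + |v|²)` of the diagonal entries of a matrix of `Sp(1,1)` with polar
coordinates `(v, s, t)`. -/
noncomputable def diagNorm (v : ℍ[ℝ]) : ℝ := √(1 + ‖v‖ ^ 2)

theorem diagNorm_pos (v : ℍ[ℝ]) : 0 < diagNorm v := Real.sqrt_pos.2 (by positivity)

theorem diagNorm_sq (v : ℍ[ℝ]) : diagNorm v ^ 2 = 1 + ‖v‖ ^ 2 := Real.sq_sqrt (by positivity)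

theorem diagNorm_congr {v w : ℍ[ℝ]} (h : ‖v‖ = ‖w‖) : diagNorm v = diagNorm w := by
  rw [diagNorm, h, diagNorm]

theorem contDiff_diagNorm : ContDiff ℝ ∞ diagNorm :=
  (contDiff_const.add (contDiff_norm_sq ℝ)).sqrt fun v => by positivity

theorem Sp11.diagNorm_apply_one_zero (A : Sp11) : diagNorm (A.1 1 0) = ‖A.1 1 1‖ := by
  rw [diagNorm, ← norm_sq_apply_one_one', Real.sqrt_sq (norm_nonneg _)]

theorem mul_star_mul_eq_norm_sq_smul (x y : ℍ[ℝ]) : x * star y * y = ‖y‖ ^ 2 • x := by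
  rw [mul_assoc, Quaternion.star_mul_self, Quaternion.normSq_eq_norm_mul_self, ← sq,
    Quaternion.mul_coe_eq_smul]

/-- The entries of the matrix with polar coordinates `(v, s, t)`, for arbitrary `s` and `t`. -/
noncomputable def coordEntries (p : ℍ[ℝ] × ℍ[ℝ] × ℍ[ℝ]) : Fin 2 → Fin 2 → ℍ[ℝ] :=
  ![![diagNorm p.1 • p.2.1, star p.1 * p.2.2], ![p.1 * p.2.1, diagNorm p.1 • p.2.2]]

/-- The polar coordinates `(v, s, t)` in terms of the matrix entries; the formula is chosen to be
smooth on the whole space of matrices. -/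
noncomputable def entryCoords (x : Fin 2 → Fin 2 → ℍ[ℝ]) : ℍ[ℝ] × ℍ[ℝ] × ℍ[ℝ] :=
  ((diagNorm (x 1 0))⁻¹ • (x 1 0 * star (x 0 0)), (diagNorm (x 1 0))⁻¹ • x 0 0,
    (diagNorm (x 1 0))⁻¹ • x 1 1)

theorem contDiff_coordEntries : ContDiff ℝ ∞ coordEntries := by
  have diag : ContDiff ℝ ∞ fun p : ℍ[ℝ] × ℍ[ℝ] × ℍ[ℝ] => diagNorm p.1 :=
    contDiff_diagNorm.comp contDiff_fst
  have conj : ContDiff ℝ ∞ fun p : ℍ[ℝ] × ℍ[ℝ] × ℍ[ℝ] => star p.1 :=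
    (starL' ℝ).contDiff.comp contDiff_fst
  simp only [contDiff_pi, Fin.forall_fin_two]
  exact ⟨⟨diag.smul contDiff_snd.fst, conj.mul contDiff_snd.snd⟩,
    contDiff_fst.mul contDiff_snd.fst, diag.smul contDiff_snd.snd⟩

theorem contDiff_entryCoords : ContDiff ℝ ∞ entryCoords := by
  have entry (i j) : ContDiff ℝ ∞ fun x : Fin 2 → Fin 2 → ℍ[ℝ] => x i j :=
    contDiff_apply_apply ℝ ℍ[ℝ] i j
  have diag : ContDiff ℝ ∞ fun x : Fin 2 → Fin 2 → ℍ[ℝ] => (diagNorm (x 1 0))⁻¹ :=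
    (contDiff_diagNorm.comp (entry 1 0)).inv fun x => (diagNorm_pos _).ne'
  exact (diag.smul ((entry 1 0).mul ((starL' ℝ).contDiff.comp (entry 0 0)))).prodMk
    ((diag.smul (entry 0 0)).prodMk (diag.smul (entry 1 1)))

/-- The inclusion of `ℍ × S³ × S³` into `ℍ³`. -/
def coordIncl : ℍ[ℝ] × QSphere × QSphere → ℍ[ℝ] × ℍ[ℝ] × ℍ[ℝ] :=
  Prod.map id (Prod.map (↑) (↑))

theorem coordIncl_injective : Function.Injective coordIncl :=
  Function.injective_id.prodMap (Subtype.val_injective.prodMap Subtype.val_injective)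

theorem coordEntries_coordIncl_mem (p : ℍ[ℝ] × QSphere × QSphere) :
    Matrix.of (coordEntries (coordIncl p)) ∈ Sp11 := by
  refine mem_Sp11_iff_norm.2 ⟨?_, ?_, ?_⟩ <;>
    simp [coordEntries, coordIncl, norm_smul, diagNorm_sq, mul_assoc]

theorem entryCoords_coordEntries (p : ℍ[ℝ] × QSphere × QSphere) :
    entryCoords (coordEntries (coordIncl p)) = coordIncl p := by
  obtain ⟨v, s, t⟩ := p
  have diagNorm_eq : diagNorm (v * s) = diagNorm v := diagNorm_congr (by simp)
  have mul_star_self : (s : ℍ[ℝ]) * star (s : ℍ[ℝ]) = 1 := by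
    simp [Quaternion.self_mul_star, Quaternion.normSq_eq_norm_mul_self]
  simp [entryCoords, coordEntries, coordIncl, diagNorm_eq, mul_assoc, mul_star_self,
    (diagNorm_pos v).ne']

namespace Sp11

variable (A : Sp11)

theorem coordEntries_entryCoords : coordEntries (entryCoords (incl A)) = incl A := by
  have hd : ‖A.1 1 1‖ ≠ 0 := norm_ne_zero_iff.2 (apply_one_one_ne_zero A)
  have diagNorm_eq : diagNorm (‖A.1 1 1‖⁻¹ • (A.1 1 0 * star (A.1 0 0))) = ‖A.1 1 1‖ := by
    rw [← diagNorm_apply_one_zero A]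
    refine diagNorm_congr ?_
    rw [diagNorm_apply_one_zero, norm_smul, norm_mul, norm_star, norm_apply_zero_zero,
      norm_inv, norm_norm, mul_comm, mul_inv_cancel_right₀ hd]
  have entry_one_zero : A.1 1 0 * star (A.1 0 0) * A.1 0 0 = ‖A.1 1 1‖ ^ 2 • A.1 1 0 := by
    rw [mul_star_mul_eq_norm_sq_smul, norm_apply_zero_zero]
  have entry_zero_one : A.1 0 0 * star (A.1 1 0) * A.1 1 1 = ‖A.1 1 1‖ ^ 2 • A.1 0 1 := by
    rw [apply_mul_star_apply, mul_star_mul_eq_norm_sq_smul]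
  funext i j
  fin_cases i <;> fin_cases j <;>
    simp [coordEntries, entryCoords, incl, diagNorm_apply_one_zero, diagNorm_eq, smul_smul,
      entry_one_zero, entry_zero_one, hd, sq]

theorem incl_injective : Function.Injective incl := fun _ _ h => Subtype.ext h

/-- The polar coordinates `(v, s, t)` on `Sp(1,1)`: the matrix has the rows `(√(1 + |v|²) s, v̄ t)`
and `(v s, √(1 + |v|²) t)`. -/
noncomputable def coords : Sp11 ≃ ℍ[ℝ] × QSphere × QSphere where
  toFun A := ((entryCoords (incl A)).1,
    ⟨(entryCoords (incl A)).2.1, by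
      simp [entryCoords, incl, diagNorm_apply_one_zero, norm_smul, norm_apply_zero_zero,
        apply_one_one_ne_zero]⟩,
    ⟨(entryCoords (incl A)).2.2, by
      simp [entryCoords, incl, diagNorm_apply_one_zero, norm_smul, apply_one_one_ne_zero]⟩)
  invFun p := ⟨Matrix.of (coordEntries (coordIncl p)), coordEntries_coordIncl_mem p⟩
  left_inv A := incl_injective (coordEntries_entryCoords A)
  right_inv p := coordIncl_injective (entryCoords_coordEntries p)

theorem incl_eq : incl = (coordEntries ∘ coordIncl) ∘ coords :=
  funext fun A => (coordEntries_entryCoords A).symm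

theorem coords_mul_scalar (u : QSphere) :
    coords (A * scalar u) = ((coords A).1, (coords A).2.1 * u, (coords A).2.2 * u) := by
  refine (Equiv.eq_symm_apply _).1 (incl_injective (funext₂ fun i j => ?_))
  have entry : (A * scalar u).1 i j = coordEntries (coordIncl (coords A)) i j * u := by
    rw [mul_scalar_apply]
    exact congrArg (· * (u : ℍ[ℝ])) (congrFun₂ (coordEntries_entryCoords A).symm i j)
  refine entry.trans ?_
  fin_cases i <;> fin_cases j <;> simp [incl, coords, coordEntries, coordIncl, mul_assoc]

end Sp11

/-! ### The smooth structures of `Sp(1,1)` and `Sp(1,1) / Sp(1) I₂` -/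

/-- The model of `ℍ × S³ × S³`. -/
noncomputable abbrev groupModel := 𝓘(ℝ, ℍ[ℝ]).prod ((𝓡 3).prod (𝓡 3))

/-- The model of `ℍ × S³`. -/
noncomputable abbrev quotientModel := 𝓘(ℝ, ℍ[ℝ]).prod (𝓡 3)

namespace QSphere

theorem contMDiff_coe : ContMDiff (𝓡 3) 𝓘(ℝ, ℍ[ℝ]) ∞ ((↑) : QSphere → ℍ[ℝ]) :=
  contMDiff_coe_sphere

theorem mdifferentiable_coe : MDifferentiable (𝓡 3) 𝓘(ℝ, ℍ[ℝ]) ((↑) : QSphere → ℍ[ℝ]) :=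
  contMDiff_coe.mdifferentiable (by simp)

theorem mfderiv_coe_injective (s : QSphere) :
    Function.Injective (mfderiv (𝓡 3) 𝓘(ℝ, ℍ[ℝ]) ((↑) : QSphere → ℍ[ℝ]) s) :=
  injective_mvfderiv_subtypeVal_sphere (E := ℍ[ℝ]) (n := 3) s

theorem coe_inv (s : QSphere) : ((s⁻¹ : QSphere) : ℍ[ℝ]) = star (s : ℍ[ℝ]) := by
  rw [Metric.unitSphere.coe_inv, Quaternion.inv_def, Quaternion.normSq_eq_norm_mul_self]
  simp

theorem contMDiff_mul_inv : ContMDiff ((𝓡 3).prod (𝓡 3)) (𝓡 3) ∞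
    fun p : QSphere × QSphere => p.1 * p.2⁻¹ := by
  refine ContMDiff.codRestrict_sphere (n := 3)
    (f := fun p : QSphere × QSphere => ((p.1 * p.2⁻¹ : QSphere) : ℍ[ℝ])) ?_
    fun p => (p.1 * p.2⁻¹).2
  simp only [Metric.unitSphere.coe_mul, coe_inv]
  have conj : ContMDiff ((𝓡 3).prod (𝓡 3)) 𝓘(ℝ, ℍ[ℝ]) ∞
      fun p : QSphere × QSphere => star (p.2 : ℍ[ℝ]) :=
    (starL' ℝ).contDiff.contMDiff.comp (contMDiff_coe.comp contMDiff_snd)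
  exact (contDiff_mul (𝕜 := ℝ) (𝔸 := ℍ[ℝ])).contMDiff.comp
    ((contMDiff_coe.comp contMDiff_fst).prodMk_space conj)

theorem contMDiff_mul_right (s : QSphere) : ContMDiff (𝓡 3) (𝓡 3) ∞ fun r : QSphere => r * s := by
  have h := contMDiff_mul_inv.comp ((contMDiff_id (M := QSphere)).prodMk
    (contMDiff_const (c := s⁻¹)))
  simpa only [Function.comp_def, id, inv_inv] using h

end QSphere

theorem contMDiff_coordIncl : ContMDiff groupModel 𝓘(ℝ, ℍ[ℝ] × ℍ[ℝ] × ℍ[ℝ]) ∞ coordIncl :=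
  contMDiff_fst.prodMk_space
    ((QSphere.contMDiff_coe.comp contMDiff_snd.fst).prodMk_space
      (QSphere.contMDiff_coe.comp contMDiff_snd.snd))

theorem isEmbedding_coordIncl : IsEmbedding coordIncl :=
  IsEmbedding.id.prodMap (IsEmbedding.subtypeVal.prodMap IsEmbedding.subtypeVal)

theorem mfderiv_coordIncl_injective (p : ℍ[ℝ] × QSphere × QSphere) :
    Function.Injective (mfderiv groupModel 𝓘(ℝ, ℍ[ℝ] × ℍ[ℝ] × ℍ[ℝ]) coordIncl p) := by
  have coe_prod : MDifferentiable ((𝓡 3).prod (𝓡 3)) 𝓘(ℝ, ℍ[ℝ] × ℍ[ℝ])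
      (Prod.map (↑) (↑) : QSphere × QSphere → ℍ[ℝ] × ℍ[ℝ]) :=
    (QSphere.mdifferentiable_coe.comp mdifferentiable_fst).prodMk_space
      (QSphere.mdifferentiable_coe.comp mdifferentiable_snd)
  refine mfderiv_prodMap_injective mdifferentiableAt_id (coe_prod _) ?_
    (mfderiv_prodMap_injective (QSphere.mdifferentiable_coe _) (QSphere.mdifferentiable_coe _)
      (QSphere.mfderiv_coe_injective _) (QSphere.mfderiv_coe_injective _))
  rw [mfderiv_id]
  exact Function.injective_id

theorem entryCoords_comp_coordEntries_comp_coordIncl :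
    entryCoords ∘ coordEntries ∘ coordIncl = coordIncl :=
  funext entryCoords_coordEntries

theorem contMDiff_coordEntries_comp_coordIncl :
    ContMDiff groupModel 𝓘(ℝ, Fin 2 → Fin 2 → ℍ[ℝ]) ∞ (coordEntries ∘ coordIncl) :=
  contDiff_coordEntries.contMDiff.comp contMDiff_coordIncl

theorem isEmbedding_coordEntries_comp_coordIncl : IsEmbedding (coordEntries ∘ coordIncl) := by
  refine IsEmbedding.of_comp contMDiff_coordEntries_comp_coordIncl.continuous
    contDiff_entryCoords.continuous ?_
  rw [entryCoords_comp_coordEntries_comp_coordIncl]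
  exact isEmbedding_coordIncl

theorem mfderiv_coordEntries_comp_coordIncl_injective (p : ℍ[ℝ] × QSphere × QSphere) :
    Function.Injective
      (mfderiv groupModel 𝓘(ℝ, Fin 2 → Fin 2 → ℍ[ℝ]) (coordEntries ∘ coordIncl) p) := by
  refine mfderiv_injective_of_comp
    (contDiff_entryCoords.contMDiff.mdifferentiable (by simp) _)
    (contMDiff_coordEntries_comp_coordIncl.mdifferentiable (by simp) _) ?_
  rw [entryCoords_comp_coordEntries_comp_coordIncl]
  exact mfderiv_coordIncl_injective p

/-- The smooth structure of `Sp(1,1)` given by its polar coordinates. -/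
noncomputable def Sp11.smoothStructure : SmoothStructure Sp11 :=
  SmoothStructure.ofEquiv groupModel coords

theorem Sp11.isSubmanifoldStructure : IsSubmanifoldStructure smoothStructure := by
  rw [IsSubmanifoldStructure, incl_eq]
  exact SmoothStructure.isEmbeddingInto_ofEquiv groupModel coords
    isEmbedding_coordEntries_comp_coordIncl contMDiff_coordEntries_comp_coordIncl
    mfderiv_coordEntries_comp_coordIncl_injective

/-- The projection `(v, s, t) ↦ (v, t s⁻¹)`, whose fibres are the orbits of the right
multiplication by `Sp(1) I₂`. -/
noncomputable def coordProj (p : ℍ[ℝ] × QSphere × QSphere) : ℍ[ℝ] × QSphere :=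
  (p.1, p.2.2 * p.2.1⁻¹)

/-- The section `(v, r) ↦ (v, s, r s)` of `coordProj`. -/
noncomputable def coordSection (s : QSphere) (p : ℍ[ℝ] × QSphere) : ℍ[ℝ] × QSphere × QSphere :=
  (p.1, s, p.2 * s)

theorem contMDiff_coordProj : ContMDiff groupModel quotientModel ∞ coordProj :=
  contMDiff_fst.prodMk
    (QSphere.contMDiff_mul_inv.comp (contMDiff_snd.snd.prodMk contMDiff_snd.fst))

theorem contMDiff_coordSection (s : QSphere) :
    ContMDiff quotientModel groupModel ∞ (coordSection s) :=
  contMDiff_fst.prodMk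
    (contMDiff_const.prodMk ((QSphere.contMDiff_mul_right s).comp contMDiff_snd))

theorem coordProj_coordSection (s : QSphere) : Function.RightInverse (coordSection s) coordProj :=
  fun p => by simp [coordProj, coordSection]

theorem coordSection_coordProj (p : ℍ[ℝ] × QSphere × QSphere) :
    coordSection p.2.1 (coordProj p) = p := by
  simp [coordProj, coordSection]

theorem mfderiv_coordProj_surjective (p : ℍ[ℝ] × QSphere × QSphere) :
    Function.Surjective (mfderiv groupModel quotientModel coordProj p) :=
  mfderiv_surjective_of_rightInverse (contMDiff_coordProj.mdifferentiable (by simp) _)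
    ((contMDiff_coordSection p.2.1).mdifferentiable (by simp) _) (coordSection_coordProj p)
    (coordProj_coordSection _)

theorem coordProj_eq_iff {p p' : ℍ[ℝ] × QSphere × QSphere} :
    coordProj p = coordProj p' ↔ ∃ u, p' = (p.1, p.2.1 * u, p.2.2 * u) := by
  constructor
  · intro h
    obtain ⟨fst_eq, mul_inv_eq⟩ :
        p.1 = p'.1 ∧ p.2.2 * p.2.1⁻¹ = p'.2.2 * p'.2.1⁻¹ := Prod.ext_iff.1 h
    refine ⟨p.2.1⁻¹ * p'.2.1, Prod.ext fst_eq.symm (Prod.ext ?_ ?_)⟩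
    · simp
    · exact (mul_inv_eq_iff_eq_mul.1 mul_inv_eq.symm).trans (mul_assoc _ _ _)
  · rintro ⟨u, rfl⟩
    simp [coordProj]

theorem coordProj_coords_eq_iff {A B : Sp11} :
    coordProj (Sp11.coords A) = coordProj (Sp11.coords B) ↔ A⁻¹ * B ∈ Sp1I2 := by
  simp only [coordProj_eq_iff, Sp11.inv_mul_mem_Sp1I2_iff, ← Sp11.coords_mul_scalar,
    Sp11.coords.injective.eq_iff]

/-- The coordinates `(v, t s⁻¹)` on `Sp(1,1) / Sp(1) I₂`. -/
noncomputable def quotientCoords : Sp11 ⧸ Sp1I2 ≃ ℍ[ℝ] × QSphere where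
  toFun := Quotient.lift (coordProj ∘ Sp11.coords) fun _ _ h =>
    coordProj_coords_eq_iff.2 (QuotientGroup.leftRel_apply.1 h)
  invFun p := (Sp11.coords.symm (coordSection 1 p) : Sp11)
  left_inv x := by
    induction x using QuotientGroup.induction_on with | H A => ?_
    refine QuotientGroup.eq.2 (coordProj_coords_eq_iff.1 ?_)
    rw [Equiv.apply_symm_apply, coordProj_coordSection]
    rfl
  right_inv p := by
    change coordProj (Sp11.coords (Sp11.coords.symm _)) = p
    rw [Equiv.apply_symm_apply, coordProj_coordSection]

theorem mk_eq_quotientCoords_symm_comp :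
    (fun A : Sp11 => (A : Sp11 ⧸ Sp1I2)) = quotientCoords.symm ∘ coordProj ∘ Sp11.coords :=
  funext fun A => (quotientCoords.symm_apply_apply (A : Sp11 ⧸ Sp1I2)).symm

/-- The smooth structure of `Sp(1,1) / Sp(1) I₂` given by the coordinates `(v, t s⁻¹)`. -/
noncomputable def quotientSmoothStructure : SmoothStructure (Sp11 ⧸ Sp1I2) :=
  SmoothStructure.ofEquiv quotientModel quotientCoords

theorem dim_quotientSmoothStructure : quotientSmoothStructure.dim = 7 := by
  rw [quotientSmoothStructure, SmoothStructure.dim_ofEquiv, Module.finrank_prod,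
    Quaternion.finrank_eq_four, finrank_euclideanSpace_fin]

theorem isQuotientStructure_quotientSmoothStructure :
    IsQuotientStructure Sp11.smoothStructure quotientSmoothStructure := by
  rw [IsQuotientStructure, mk_eq_quotientCoords_symm_comp]
  exact SmoothStructure.isSurjectiveSubmersion_ofEquiv groupModel Sp11.coords quotientCoords
    (coordProj_coordSection 1).surjective contMDiff_coordProj mfderiv_coordProj_surjective

/-! ### The bijection `ψ` -/

/-- The map `ψ : A Sp(1) I₂ ↦ 𝓕_{A⁻¹}`. -/
noncomputable def mobiusOfCoset : Sp11 ⧸ Sp1I2 → RegularMobiusMaps :=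
  Quotient.lift
    (fun A : Sp11 =>
      (⟨fun q => ⟨regularMobius A⁻¹ q, mem_ball_zero_iff.2 (norm_regularMobius_lt_one A⁻¹ q)⟩,
        A⁻¹, fun _ => rfl⟩ : RegularMobiusMaps))
    fun A B h => by
      have mem : A⁻¹ * B⁻¹⁻¹ ∈ Sp1I2 := by rw [inv_inv]; exact QuotientGroup.leftRel_apply.1 h
      exact Subtype.ext (funext fun q =>
        Subtype.ext (congrFun (regularMobius_eq_iff.2 mem) q).symm)

theorem coe_mobiusOfCoset_mk (A : Sp11) (q : QBall) :
    ((mobiusOfCoset (A : Sp11 ⧸ Sp1I2) : QBall → QBall) q : ℍ[ℝ]) = regularMobius A⁻¹ q := rfl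

theorem mobiusOfCoset_injective : Function.Injective mobiusOfCoset := by
  intro x y h
  induction x using QuotientGroup.induction_on with | H A => ?_
  induction y using QuotientGroup.induction_on with | H B => ?_
  have mobius_eq : regularMobius B⁻¹ = regularMobius A⁻¹ := by
    funext q
    rw [← coe_mobiusOfCoset_mk, ← coe_mobiusOfCoset_mk, h]
  refine QuotientGroup.eq.2 ?_
  simpa using regularMobius_eq_iff.1 mobius_eq

theorem mobiusOfCoset_surjective : Function.Surjective mobiusOfCoset := by
  rintro ⟨F, A, hA⟩
  refine ⟨(A⁻¹ : Sp11), Subtype.ext (funext fun q => Subtype.ext ?_)⟩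
  rw [coe_mobiusOfCoset_mk, inv_inv, hA]

/-- The bijection `ψ` between `Sp(1,1) / Sp(1) I₂` and `𝓜(𝔹)`, as an equivalence. -/
noncomputable def cosetEquivMobius : Sp11 ⧸ Sp1I2 ≃ RegularMobiusMaps :=
  Equiv.ofBijective mobiusOfCoset ⟨mobiusOfCoset_injective, mobiusOfCoset_surjective⟩

instance nonempty_regularMobiusMaps : Nonempty RegularMobiusMaps :=
  cosetEquivMobius.nonempty_congr.1 inferInstance

theorem dim_eq_of_isDiffeomorphism_cosetEquivMobius {S : SmoothStructure RegularMobiusMaps}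
    (hS : quotientSmoothStructure.IsDiffeomorphism S cosetEquivMobius) : S.dim = 7 := by
  obtain ⟨smooth, smooth_symm⟩ := SmoothStructure.isDiffeomorphism_iff.1 hS
  exact (SmoothStructure.dim_eq_of_smoothMap _ smooth smooth_symm).symm.trans
    dim_quotientSmoothStructure

theorem mainTheorem2 :
    ∃ ψ : Sp11 ⧸ Sp1I2 → RegularMobiusMaps,
      -- the map `A Sp(1)I₂ ↦ 𝓕_{A⁻¹}` is well defined and bijective
      (∀ (A : Sp11) (q : QBall),
        ((ψ (A : Sp11 ⧸ Sp1I2) : QBall → QBall) q : ℍ[ℝ]) = regularMobius A⁻¹ q) ∧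
      Function.Bijective ψ ∧
      -- the manifold structures of `Sp(1,1)` and of the quotient exist and are unique
      (∃! G : SmoothStructure Sp11, IsSubmanifoldStructure G) ∧
      ∀ G : SmoothStructure Sp11, IsSubmanifoldStructure G →
        (∃! Q : SmoothStructure (Sp11 ⧸ Sp1I2), IsQuotientStructure G Q) ∧
        ∀ Q : SmoothStructure (Sp11 ⧸ Sp1I2), IsQuotientStructure G Q →
          -- there is a unique manifold structure making `ψ` a diffeomorphism; its dimension is 7
          (∃! S : SmoothStructure RegularMobiusMaps, Q.IsDiffeomorphism S ψ) ∧
          ∀ S : SmoothStructure RegularMobiusMaps, Q.IsDiffeomorphism S ψ → S.dim = 7 := by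
  refine ⟨cosetEquivMobius, coe_mobiusOfCoset_mk, cosetEquivMobius.bijective,
    ⟨_, Sp11.isSubmanifoldStructure, fun _ hG => hG.unique Sp11.isSubmanifoldStructure⟩,
    fun G hG => ?_⟩
  obtain rfl : G = Sp11.smoothStructure := hG.unique Sp11.isSubmanifoldStructure
  refine ⟨⟨_, isQuotientStructure_quotientSmoothStructure, fun _ hQ =>
    hQ.unique isQuotientStructure_quotientSmoothStructure⟩, fun Q hQ => ?_⟩
  obtain rfl : Q = quotientSmoothStructure :=
    hQ.unique isQuotientStructure_quotientSmoothStructure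
  obtain ⟨S, hS⟩ := quotientSmoothStructure.exists_isDiffeomorphism cosetEquivMobius
  exact ⟨⟨S, hS, fun _ hS' => hS'.unique hS⟩,
    fun _ => dim_eq_of_isDiffeomorphism_cosetEquivMobius⟩
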